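/- All graphs are finite, simple and undirected. A b-coloring of a graph $G$ with $k$ colors is a proper coloring of the vertices using exactly $k$ colors such that every color class contains a vertex that has a neighbour in each of the other $k-1$ color classes. The b-chromatic number $b(G)$ is the largest integer $k$ such that $G$ admits a b-coloring with exactly $k$ colors, and $\chi(G)$ denotes the chromatic number. A graph $G$ is b-perfect if $b(H)=\chi(H)$ for every induced subgraph $H$ of $G$. A graph $G$ is $\mathcal{H}$-free, for a family $\mathcal{H}$ of graphs, if no induced subgraph of $G$ is isomorphic to a member of $\mathcal{H}$; $C_4$ is the cycle on four vertices. Let $\mathcal{F}=\{F_1,\dots,F_{22}\}$ be the following family of graphs, each given by its vertex set and the list of its edges, where $ij$ stands for the edge $\{i,j\}$: - $F_{1}$: $\{0,\dots,4\}$; 03, 13, 14, 24 (this is the path $P_5$); - $F_{2}$: $\{0,\dots,6\}$; 04, 14, 25, 36, 56 (this is $P_4+P_3$); - $F_{3}$: $\{0,\dots,8\}$; 06, 16, 27, 37, 48, 58 (this is $3P_3$); - $F_{4}$: $\{0,\dots,5\}$; 01, 02, 04, 05, 13, 15, 24, 35, 45; - $F_{5}$: $\{0,\dots,6\}$; 02,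 03, 05, 13, 14, 25, 34, 35, 36, 46; - $F_{6}$: $\{0,\dots,7\}$; 02, 03, 14, 15, 23, 26, 36, 45, 47, 57; - $F_{7}$: $\{0,\dots,7\}$; 02, 03, 14, 15, 23, 26, 34, 36, 45, 47, 57; - $F_{8}$: $\{0,\dots,7\}$; 01, 04, 12, 14, 23, 24, 34, 45, 56, 57, 67; - $F_{9}$: $\{0,\dots,9\}$; 01, 06, 12, 16, 26, 34, 36, 45, 46, 56, 67, 78, 79, 89; - $F_{10}$: $\{0,\dots,5\}$; 01, 02, 04, 13, 15, 23, 24, 25, 35, 45; - $F_{11}$: $\{0,\dots,6\}$; 02, 03, 05, 12, 13, 14, 25, 26, 34, 35, 36, 46; - $F_{12}$: $\{0,\dots,7\}$; 01, 05, 12, 14, 15, 23, 26, 27, 36, 45, 56, 67; - $F_{13}$: $\{0,\dots,7\}$; 01, 04, 05, 12, 14, 16, 23, 25, 27, 36, 37, 45, 56, 67; - $F_{14}$: $\{0,\dots,7\}$; 01, 04, 06, 12, 15, 16, 23, 24, 27, 35, 37, 45, 46, 57, 67; - $F_{15}$: $\{0,\dots,7\}$; 01, 02, 04, 06, 13, 15,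 17, 23, 25, 26, 34, 37, 45, 46, 57, 67; - $F_{16}$: $\{0,\dots,5\}$; 01, 03, 14, 23, 24, 25, 35, 45; - $F_{17}$: $\{0,\dots,5\}$; 01, 03, 12, 14, 23, 24, 25, 35, 45; - $F_{18}$: $\{0,\dots,7\}$; 01, 02, 04, 13, 16, 24, 25, 26, 34, 35, 36, 47, 67; - $F_{19}$: $\{0,\dots,7\}$; 01, 02, 04, 13, 15, 23, 26, 27, 36, 37, 46, 47, 56, 57; - $F_{20}$: $\{0,\dots,7\}$; 01, 03, 04, 12, 16, 23, 24, 25, 36, 37, 45, 47, 56, 67; - $F_{21}$: $\{0,\dots,7\}$; 01, 03, 04, 05, 12, 16, 23, 24, 25, 36, 37, 45, 47, 56, 67; - $F_{22}$: $\{0,\dots,7\}$; 01, 02, 03, 05, 12, 14, 16, 27, 34, 37, 45, 47, 56, 57, 67. Theorem. Every graph that is $\mathcal{F}$-free and $C_4$-free is b-perfect. -/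

import Mathlib

/-!
# b-colorings, b-perfect graphs and the family of twenty-two forbidden graphs
-/

namespace BPerfect

/-- `C` is a b-coloring of `G` with exactly `k` colors: `C` is a proper coloring with color set
`Fin k` in which every color class contains a b-vertex, that is, a vertex that has a neighbour of
each of the other colors.  In particular all `k` color classes are nonempty. -/
def IsBColoring {V : Type*} (G : SimpleGraph V) {k : ℕ} (C : G.Coloring (Fin k)) : Prop :=
  ∀ i : Fin k, ∃ v : V, C v = i ∧ ∀ j : Fin k, j ≠ i → ∃ w : V, G.Adj v w ∧ C w = j

/-- `G` admits a b-coloring with exactly `k` colors. -/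
def HasBColoring {V : Type*} (G : SimpleGraph V) (k : ℕ) : Prop :=
  ∃ C : G.Coloring (Fin k), IsBColoring G C

/-- On a finite graph the number of colors of a b-coloring is at most the number of vertices, so
the supremum in `bChromaticNumber` below is taken over a bounded set. -/
theorem HasBColoring.le_card {V : Type*} [Finite V] {G : SimpleGraph V} {k : ℕ}
    (h : HasBColoring G k) : k ≤ Nat.card V := by
  obtain ⟨C, hC⟩ := h
  have hs : Function.Surjective C := fun i => (hC i).imp fun _ hv => hv.1
  simpa using Nat.card_le_card_of_surjective C hs

/-- The b-chromatic number of a finite graph: the largest `k` such that the graph admits a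
b-coloring with exactly `k` colors. -/
noncomputable def bChromaticNumber {V : Type*} (G : SimpleGraph V) : ℕ :=
  sSup {k : ℕ | HasBColoring G k}

/-- A (finite) graph is b-perfect if every induced subgraph has b-chromatic number equal to its
chromatic number. -/
def IsBPerfect {V : Type*} (G : SimpleGraph V) : Prop :=
  ∀ s : Set V, (bChromaticNumber (G.induce s) : ℕ∞) = (G.induce s).chromaticNumber

/-- The graph with vertex set `{0, …, n - 1}` whose edges are the listed pairs. -/
def ofEdges (n : ℕ) (E : List (Fin n × Fin n)) : SimpleGraph (Fin n) :=
  SimpleGraph.fromRel fun i j => (i, j) ∈ E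

instance (n : ℕ) (E : List (Fin n × Fin n)) : DecidableRel (ofEdges n E).Adj :=
  fun i j => inferInstanceAs (Decidable (i ≠ j ∧ ((i, j) ∈ E ∨ (j, i) ∈ E)))

/-- The graph `F1` (the path on five vertices). -/
def F1 : SimpleGraph (Fin 5) :=
  ofEdges 5 [(0, 3), (1, 3), (1, 4), (2, 4)]

/-- The graph `F2`
(the disjoint union of a path on four vertices and a path on three vertices). -/
def F2 : SimpleGraph (Fin 7) :=
  ofEdges 7 [(0, 4), (1, 4), (2, 5), (3, 6), (5, 6)]

/-- The graph `F3` (three disjoint paths on three vertices). -/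
def F3 : SimpleGraph (Fin 9) :=
  ofEdges 9 [(0, 6), (1, 6), (2, 7), (3, 7), (4, 8), (5, 8)]

/-- The graph `F4`. -/
def F4 : SimpleGraph (Fin 6) :=
  ofEdges 6 [(0, 1), (0, 2), (0, 4), (0, 5), (1, 3), (1, 5), (2, 4), (3, 5), (4, 5)]

/-- The graph `F5`. -/
def F5 : SimpleGraph (Fin 7) :=
  ofEdges 7 [(0, 2), (0, 3), (0, 5), (1, 3), (1, 4), (2, 5), (3, 4), (3, 5), (3, 6), (4, 6)]

/-- The graph `F6`. -/
def F6 : SimpleGraph (Fin 8) :=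
  ofEdges 8 [(0, 2), (0, 3), (1, 4), (1, 5), (2, 3), (2, 6), (3, 6), (4, 5), (4, 7), (5, 7)]

/-- The graph `F7`. -/
def F7 : SimpleGraph (Fin 8) :=
  ofEdges 8 [(0, 2), (0, 3), (1, 4), (1, 5), (2, 3), (2, 6), (3, 4), (3, 6), (4, 5), (4, 7),
    (5, 7)]

/-- The graph `F8`. -/
def F8 : SimpleGraph (Fin 8) :=
  ofEdges 8 [(0, 1), (0, 4), (1, 2), (1, 4), (2, 3), (2, 4), (3, 4), (4, 5), (5, 6), (5, 7),
    (6, 7)]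

/-- The graph `F9`. -/
def F9 : SimpleGraph (Fin 10) :=
  ofEdges 10 [(0, 1), (0, 6), (1, 2), (1, 6), (2, 6), (3, 4), (3, 6), (4, 5), (4, 6), (5, 6),
    (6, 7), (7, 8), (7, 9), (8, 9)]

/-- The graph `F10`. -/
def F10 : SimpleGraph (Fin 6) :=
  ofEdges 6 [(0, 1), (0, 2), (0, 4), (1, 3), (1, 5), (2, 3), (2, 4), (2, 5), (3, 5), (4, 5)]

/-- The graph `F11`. -/
def F11 : SimpleGraph (Fin 7) :=
  ofEdges 7 [(0, 2), (0, 3), (0, 5), (1, 2), (1, 3), (1, 4), (2, 5), (2, 6), (3, 4), (3, 5),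
    (3, 6), (4, 6)]

/-- The graph `F12`. -/
def F12 : SimpleGraph (Fin 8) :=
  ofEdges 8 [(0, 1), (0, 5), (1, 2), (1, 4), (1, 5), (2, 3), (2, 6), (2, 7), (3, 6), (4, 5),
    (5, 6), (6, 7)]

/-- The graph `F13`. -/
def F13 : SimpleGraph (Fin 8) :=
  ofEdges 8 [(0, 1), (0, 4), (0, 5), (1, 2), (1, 4), (1, 6), (2, 3), (2, 5), (2, 7), (3, 6),
    (3, 7), (4, 5), (5, 6), (6, 7)]

/-- The graph `F14`. -/
def F14 : SimpleGraph (Fin 8) :=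
  ofEdges 8 [(0, 1), (0, 4), (0, 6), (1, 2), (1, 5), (1, 6), (2, 3), (2, 4), (2, 7), (3, 5),
    (3, 7), (4, 5), (4, 6), (5, 7), (6, 7)]

/-- The graph `F15`. -/
def F15 : SimpleGraph (Fin 8) :=
  ofEdges 8 [(0, 1), (0, 2), (0, 4), (0, 6), (1, 3), (1, 5), (1, 7), (2, 3), (2, 5), (2, 6),
    (3, 4), (3, 7), (4, 5), (4, 6), (5, 7), (6, 7)]

/-- The graph `F16`. -/
def F16 : SimpleGraph (Fin 6) :=
  ofEdges 6 [(0, 1), (0, 3), (1, 4), (2, 3), (2, 4), (2, 5), (3, 5), (4, 5)]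

/-- The graph `F17`. -/
def F17 : SimpleGraph (Fin 6) :=
  ofEdges 6 [(0, 1), (0, 3), (1, 2), (1, 4), (2, 3), (2, 4), (2, 5), (3, 5), (4, 5)]

/-- The graph `F18`. -/
def F18 : SimpleGraph (Fin 8) :=
  ofEdges 8 [(0, 1), (0, 2), (0, 4), (1, 3), (1, 6), (2, 4), (2, 5), (2, 6), (3, 4), (3, 5),
    (3, 6), (4, 7), (6, 7)]

/-- The graph `F19`. -/
def F19 : SimpleGraph (Fin 8) :=
  ofEdges 8 [(0, 1), (0, 2), (0, 4), (1, 3), (1, 5), (2, 3), (2, 6), (2, 7), (3, 6), (3, 7),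
    (4, 6), (4, 7), (5, 6), (5, 7)]

/-- The graph `F20`. -/
def F20 : SimpleGraph (Fin 8) :=
  ofEdges 8 [(0, 1), (0, 3), (0, 4), (1, 2), (1, 6), (2, 3), (2, 4), (2, 5), (3, 6), (3, 7),
    (4, 5), (4, 7), (5, 6), (6, 7)]

/-- The graph `F21`. -/
def F21 : SimpleGraph (Fin 8) :=
  ofEdges 8 [(0, 1), (0, 3), (0, 4), (0, 5), (1, 2), (1, 6), (2, 3), (2, 4), (2, 5), (3, 6),
    (3, 7), (4, 5), (4, 7), (5, 6), (6, 7)]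

/-- The graph `F22`. -/
def F22 : SimpleGraph (Fin 8) :=
  ofEdges 8 [(0, 1), (0, 2), (0, 3), (0, 5), (1, 2), (1, 4), (1, 6), (2, 7), (3, 4), (3, 7),
    (4, 5), (4, 7), (5, 6), (5, 7), (6, 7)]

/-- The family `{F1, …, F22}`. -/
def familyF : Set (Σ n : ℕ, SimpleGraph (Fin n)) :=
  {⟨5, F1⟩, ⟨7, F2⟩, ⟨9, F3⟩, ⟨6, F4⟩, ⟨7, F5⟩, ⟨8, F6⟩, ⟨8, F7⟩, ⟨8, F8⟩,
   ⟨10, F9⟩, ⟨6, F10⟩, ⟨7, F11⟩, ⟨8, F12⟩, ⟨8, F13⟩, ⟨8, F14⟩, ⟨8, F15⟩, ⟨6, F16⟩,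
   ⟨6, F17⟩, ⟨8, F18⟩, ⟨8, F19⟩, ⟨8, F20⟩, ⟨8, F21⟩, ⟨8, F22⟩}

/-- `G` is `ℋ`-free: no member of `ℋ` is isomorphic to an induced subgraph of `G`. -/
def IsFamilyFree {V : Type*} (ℋ : Set (Σ n : ℕ, SimpleGraph (Fin n))) (G : SimpleGraph V) : Prop :=
  ∀ H ∈ ℋ, ¬ H.2.IsIndContained G

end BPerfect

namespace BPerfect

/-! The hypotheses pass to induced subgraphs, and an optimal coloring is a b-coloring, so it
suffices that `k ≤ n` whenever an `n`-colorable graph of the class has a b-coloring with `k` colors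
(`PatternFree.le_of_hasBColoring`).

Without an induced C₅ there is even a clique of size `k` (`exists_clique`). Choose a b-vertex in
each color. A simplicial one forms a clique with neighbours in the other colors. If none is
simplicial, the key tool is domination: of two non-adjacent vertices, one has all its common
neighbours with the other complete to the rest of its neighbourhood (`dominates_or_dominates`), and
for non-simplicial vertices the private neighbourhoods are anticomplete (`not_adj_private`). Hence
no three chosen b-vertices are pairwise non-adjacent (`false_of_independent_triple`), and no two
non-adjacent pairs are disjoint (`false_of_nonadjacent_pairs`). The non-adjacencies therefore form a
star, and replacing one vertex, the centre or a leaf, by another vertex of its color gives the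
clique (`exists_clique_of_star`).

With an induced C₅, every other vertex is complete or anticomplete to it. The complete vertices form
a clique `A` with `|A| + 3 ≤ n`. If `k > n`, some color misses `A`, and the closed neighbourhood of
its b-vertex turns out to be a clique with at least `k` vertices, which is absurd
(`le_of_isPentagon`). -/

variable {V : Type*} {G : SimpleGraph V}

/-! ### Forbidden induced subgraphs as adjacency patterns -/

/-- Exhibiting an induced copy of a graph on `Fin n`: adjacency is checked for pairs `i < j` only,
and only vertices with the same neighbourhood have to be told apart. -/
theorem isIndContained_of_lt {n : ℕ} {H : SimpleGraph (Fin n)} (f : Fin n → V)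
    (hadj : ∀ i j, i < j → (G.Adj (f i) (f j) ↔ H.Adj i j))
    (htwin : ∀ i j, i < j → (∀ k, H.Adj i k ↔ H.Adj j k) → f i ≠ f j) : H.IsIndContained G := by
  have hiff : ∀ i j, G.Adj (f i) (f j) ↔ H.Adj i j := by
    intro i j
    rcases lt_trichotomy i j with hlt | rfl | hlt
    · exact hadj _ _ hlt
    · simp
    · rw [G.adj_comm, H.adj_comm]
      exact hadj _ _ hlt
  have htw : ∀ i j, f i = f j → ∀ k, H.Adj i k ↔ H.Adj j k := by
    intro i j hij k
    rw [← hiff, ← hiff, hij]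
  refine ⟨⟨⟨f, fun i j hij => ?_⟩, fun {i j} => hiff i j⟩⟩
  by_contra hne
  rcases lt_or_gt_of_ne hne with hlt | hlt
  · exact htwin _ _ hlt (htw _ _ hij) hij
  · exact htwin _ _ hlt (htw _ _ hij.symm) hij.symm

/-- The graphs without induced `C₄`, `F₁`, …, `F₉`, `F₁₆`, with each excluded pattern spelled out
as a list of edges followed by a list of non-edges. -/
structure PatternFree (G : SimpleGraph V) : Prop where
  c4 : ∀ {a b c d : V}, G.Adj a b → G.Adj b c → G.Adj c d → G.Adj d a →
    ¬ G.Adj a c → ¬ G.Adj b d → a ≠ c → b ≠ d → False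
  p5 : ∀ {a b c d e : V}, G.Adj a b → G.Adj b c → G.Adj c d → G.Adj d e →
    ¬ G.Adj a c → ¬ G.Adj a d → ¬ G.Adj a e → ¬ G.Adj b d → ¬ G.Adj b e → ¬ G.Adj c e → False
  f2 : ∀ {a b c d p q r : V}, G.Adj a b → G.Adj b c → G.Adj c d → G.Adj q p → G.Adj q r →
    ¬ G.Adj a c → ¬ G.Adj a d → ¬ G.Adj b d → ¬ G.Adj p r → p ≠ r →
    (∀ s ∈ [a, b, c, d], ∀ t ∈ [p, q, r], ¬ G.Adj s t) → False
  f3 : ∀ {a x a' b y b' c z c' : V}, G.Adj x a → G.Adj x a' → G.Adj y b → G.Adj y b' →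
    G.Adj z c → G.Adj z c' → ¬ G.Adj a a' → ¬ G.Adj b b' → ¬ G.Adj c c' →
    a ≠ a' → b ≠ b' → c ≠ c' →
    (∀ s ∈ [a, x, a'], ∀ t ∈ [b, y, b'], ¬ G.Adj s t) →
    (∀ s ∈ [a, x, a'], ∀ t ∈ [c, z, c'], ¬ G.Adj s t) →
    (∀ s ∈ [b, y, b'], ∀ t ∈ [c, z, c'], ¬ G.Adj s t) → False
  f4 : ∀ {a b c d e f : V}, G.Adj a b → G.Adj a c → G.Adj b c → G.Adj b d → G.Adj c d →
    G.Adj c e → G.Adj d e → G.Adj d f → G.Adj e f → ¬ G.Adj a d → ¬ G.Adj a e → ¬ G.Adj a f →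
    ¬ G.Adj b e → ¬ G.Adj b f → ¬ G.Adj c f → False
  f5 : ∀ {v p q r s t u : V}, G.Adj v p → G.Adj v q → G.Adj p q → G.Adj p r → G.Adj q r →
    G.Adj v s → G.Adj v t → G.Adj v u → G.Adj s t → G.Adj s u → ¬ G.Adj v r → ¬ G.Adj t u →
    t ≠ u → (∀ i ∈ [p, q, r], ∀ j ∈ [s, t, u], ¬ G.Adj i j) → False
  f6 : ∀ {a p q b c r s d : V}, G.Adj p q → G.Adj p a → G.Adj p b → G.Adj q a → G.Adj q b →
    G.Adj r s → G.Adj r c → G.Adj r d → G.Adj s c → G.Adj s d → ¬ G.Adj a b → ¬ G.Adj c d →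
    a ≠ b → c ≠ d → (∀ i ∈ [a, p, q, b], ∀ j ∈ [c, r, s, d], ¬ G.Adj i j) → False
  f7 : ∀ {a p q b c r s d : V}, G.Adj p q → G.Adj p a → G.Adj p b → G.Adj q a → G.Adj q b →
    G.Adj r s → G.Adj r c → G.Adj r d → G.Adj s c → G.Adj s d → ¬ G.Adj a b → ¬ G.Adj c d →
    a ≠ b → c ≠ d → G.Adj q r → (∀ j ∈ [c, r, s, d], ¬ G.Adj a j) →
    (∀ j ∈ [c, r, s, d], ¬ G.Adj p j) → (∀ j ∈ [c, s, d], ¬ G.Adj q j) →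
    (∀ j ∈ [c, r, s, d], ¬ G.Adj b j) → False
  f8 : ∀ {v a b c d z s t : V}, G.Adj a b → G.Adj b c → G.Adj c d → G.Adj v a → G.Adj v b →
    G.Adj v c → G.Adj v d → G.Adj v z → G.Adj z s → G.Adj z t → G.Adj s t → ¬ G.Adj a c →
    ¬ G.Adj a d → ¬ G.Adj b d → ¬ G.Adj v s → ¬ G.Adj v t →
    (∀ i ∈ [a, b, c, d], ∀ j ∈ [z, s, t], ¬ G.Adj i j) → False
  f9 : ∀ {v a x a' b y b' z s t : V}, G.Adj x a → G.Adj x a' → G.Adj y b → G.Adj y b' →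
    (∀ i ∈ [a, x, a', b, y, b', z], G.Adj v i) → G.Adj z s → G.Adj z t → G.Adj s t →
    ¬ G.Adj a a' → ¬ G.Adj b b' → a ≠ a' → b ≠ b' → ¬ G.Adj v s → ¬ G.Adj v t →
    (∀ i ∈ [a, x, a'], ∀ j ∈ [b, y, b'], ¬ G.Adj i j) →
    (∀ i ∈ [a, x, a', b, y, b'], ∀ j ∈ [z, s, t], ¬ G.Adj i j) → False
  f16 : ∀ {a b c d e f : V}, G.Adj a b → G.Adj b c → G.Adj c d → G.Adj d e → G.Adj e a →
    ¬ G.Adj a c → ¬ G.Adj a d → ¬ G.Adj b d → ¬ G.Adj b e → ¬ G.Adj c e →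
    G.Adj f a → G.Adj f b → G.Adj f c → ¬ G.Adj f d → ¬ G.Adj f e → b ≠ f → False

/-- In this and the following pattern lemmas the vector lists the vertices in the order of the
labels of the forbidden graph. Non-adjacent vertices with equal neighbourhoods, such as opposite
corners of a four-cycle, need an explicit inequality; other distinctness follows from the
adjacencies. -/
theorem c4_pattern (h : ¬ (SimpleGraph.cycleGraph 4).IsIndContained G) {a b c d : V} :
    G.Adj a b → G.Adj b c → G.Adj c d → G.Adj d a →
    ¬ G.Adj a c → ¬ G.Adj b d → a ≠ c → b ≠ d → False := by
  intros
  refine h (isIndContained_of_lt ![a, b, c, d] (fun i j hij => ?_) fun i j hij htw => ?_)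
  · clear h
    fin_cases i <;> fin_cases j <;> first
      | exact absurd hij (by decide)
      | simp_all [SimpleGraph.cycleGraph_adj, G.adj_comm] <;> decide
  · clear h
    fin_cases i <;> fin_cases j <;> first
      | exact absurd hij (by decide)
      | exact absurd htw (by simp only [SimpleGraph.cycleGraph_adj]; decide)
      | simp_all

theorem p5_pattern (h : ¬ F1.IsIndContained G) {a b c d e : V} :
    G.Adj a b → G.Adj b c → G.Adj c d → G.Adj d e →
    ¬ G.Adj a c → ¬ G.Adj a d → ¬ G.Adj a e → ¬ G.Adj b d → ¬ G.Adj b e → ¬ G.Adj c e → False := by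
  intros
  refine h (isIndContained_of_lt ![a, c, e, b, d] (fun i j hij => ?_) fun i j hij htw => ?_)
  · clear h
    fin_cases i <;> fin_cases j <;> first
      | exact absurd hij (by decide)
      | simp [F1, ofEdges, *]; done
      | simp_all [F1, ofEdges, G.adj_comm]
  · clear h
    fin_cases i <;> fin_cases j <;> first
      | exact absurd hij (by decide)
      | exact absurd htw (by simp only [F1]; decide)

theorem f2_pattern (h : ¬ F2.IsIndContained G) {a b c d p q r : V} :
    G.Adj a b → G.Adj b c → G.Adj c d → G.Adj q p → G.Adj q r →
    ¬ G.Adj a c → ¬ G.Adj a d → ¬ G.Adj b d → ¬ G.Adj p r → p ≠ r →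
    (∀ s ∈ [a, b, c, d], ∀ t ∈ [p, q, r], ¬ G.Adj s t) → False := by
  intros
  simp only [List.forall_mem_cons, List.not_mem_nil, false_imp_iff, implies_true, and_true] at *
  refine h (isIndContained_of_lt ![p, r, a, d, q, b, c] (fun i j hij => ?_) fun i j hij htw => ?_)
  · clear h
    fin_cases i <;> fin_cases j <;> first
      | exact absurd hij (by decide)
      | simp [F2, ofEdges, *]; done
      | simp_all [F2, ofEdges, G.adj_comm]
  · clear h
    fin_cases i <;> fin_cases j <;> first
      | exact absurd hij (by decide)
      | exact absurd htw (by simp only [F2]; decide)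
      | simp_all

theorem f3_pattern (h : ¬ F3.IsIndContained G) {a x a' b y b' c z c' : V} :
    G.Adj x a → G.Adj x a' → G.Adj y b → G.Adj y b' →
    G.Adj z c → G.Adj z c' → ¬ G.Adj a a' → ¬ G.Adj b b' → ¬ G.Adj c c' →
    a ≠ a' → b ≠ b' → c ≠ c' →
    (∀ s ∈ [a, x, a'], ∀ t ∈ [b, y, b'], ¬ G.Adj s t) →
    (∀ s ∈ [a, x, a'], ∀ t ∈ [c, z, c'], ¬ G.Adj s t) →
    (∀ s ∈ [b, y, b'], ∀ t ∈ [c, z, c'], ¬ G.Adj s t) → False := by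
  intros
  simp only [List.forall_mem_cons, List.not_mem_nil, false_imp_iff, implies_true, and_true] at *
  refine h (isIndContained_of_lt ![a, a', b, b', c, c', x, y, z] (fun i j hij => ?_) fun i j hij htw => ?_)
  · clear h
    fin_cases i <;> fin_cases j <;> first
      | exact absurd hij (by decide)
      | simp [F3, ofEdges, *]; done
      | simp_all [F3, ofEdges, G.adj_comm]
  · clear h
    fin_cases i <;> fin_cases j <;> first
      | exact absurd hij (by decide)
      | exact absurd htw (by simp only [F3]; decide)
      | simp_all

theorem f4_pattern (h : ¬ F4.IsIndContained G) {a b c d e f : V} :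
    G.Adj a b → G.Adj a c → G.Adj b c → G.Adj b d → G.Adj c d →
    G.Adj c e → G.Adj d e → G.Adj d f → G.Adj e f → ¬ G.Adj a d → ¬ G.Adj a e → ¬ G.Adj a f →
    ¬ G.Adj b e → ¬ G.Adj b f → ¬ G.Adj c f → False := by
  intros
  refine h (isIndContained_of_lt ![c, e, a, f, b, d] (fun i j hij => ?_) fun i j hij htw => ?_)
  · clear h
    fin_cases i <;> fin_cases j <;> first
      | exact absurd hij (by decide)
      | simp [F4, ofEdges, *]; done
      | simp_all [F4, ofEdges, G.adj_comm]
  · clear h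
    fin_cases i <;> fin_cases j <;> first
      | exact absurd hij (by decide)
      | exact absurd htw (by simp only [F4]; decide)

theorem f5_pattern (h : ¬ F5.IsIndContained G) {v p q r s t u : V} :
    G.Adj v p → G.Adj v q → G.Adj p q → G.Adj p r → G.Adj q r →
    G.Adj v s → G.Adj v t → G.Adj v u → G.Adj s t → G.Adj s u → ¬ G.Adj v r → ¬ G.Adj t u →
    t ≠ u → (∀ i ∈ [p, q, r], ∀ j ∈ [s, t, u], ¬ G.Adj i j) → False := by
  intros
  simp only [List.forall_mem_cons, List.not_mem_nil, false_imp_iff, implies_true, and_true] at *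
  refine h (isIndContained_of_lt ![p, t, r, v, s, q, u] (fun i j hij => ?_) fun i j hij htw => ?_)
  · clear h
    fin_cases i <;> fin_cases j <;> first
      | exact absurd hij (by decide)
      | simp [F5, ofEdges, *]; done
      | simp_all [F5, ofEdges, G.adj_comm]
  · clear h
    fin_cases i <;> fin_cases j <;> first
      | exact absurd hij (by decide)
      | exact absurd htw (by simp only [F5]; decide)
      | simp_all

theorem f6_pattern (h : ¬ F6.IsIndContained G) {a p q b c r s d : V} :
    G.Adj p q → G.Adj p a → G.Adj p b → G.Adj q a → G.Adj q b →
    G.Adj r s → G.Adj r c → G.Adj r d → G.Adj s c → G.Adj s d → ¬ G.Adj a b → ¬ G.Adj c d →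
    a ≠ b → c ≠ d → (∀ i ∈ [a, p, q, b], ∀ j ∈ [c, r, s, d], ¬ G.Adj i j) → False := by
  intros
  simp only [List.forall_mem_cons, List.not_mem_nil, false_imp_iff, implies_true, and_true] at *
  refine h (isIndContained_of_lt ![a, c, p, q, r, s, b, d] (fun i j hij => ?_) fun i j hij htw => ?_)
  · clear h
    fin_cases i <;> fin_cases j <;> first
      | exact absurd hij (by decide)
      | simp [F6, ofEdges, *]; done
      | simp_all [F6, ofEdges, G.adj_comm]
  · clear h
    fin_cases i <;> fin_cases j <;> first
      | exact absurd hij (by decide)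
      | exact absurd htw (by simp only [F6]; decide)
      | simp_all

theorem f7_pattern (h : ¬ F7.IsIndContained G) {a p q b c r s d : V} :
    G.Adj p q → G.Adj p a → G.Adj p b → G.Adj q a → G.Adj q b →
    G.Adj r s → G.Adj r c → G.Adj r d → G.Adj s c → G.Adj s d → ¬ G.Adj a b → ¬ G.Adj c d →
    a ≠ b → c ≠ d → G.Adj q r → (∀ j ∈ [c, r, s, d], ¬ G.Adj a j) →
    (∀ j ∈ [c, r, s, d], ¬ G.Adj p j) → (∀ j ∈ [c, s, d], ¬ G.Adj q j) →
    (∀ j ∈ [c, r, s, d], ¬ G.Adj b j) → False := by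
  intros
  simp only [List.forall_mem_cons, List.not_mem_nil, false_imp_iff, implies_true, and_true] at *
  refine h (isIndContained_of_lt ![a, c, p, q, r, s, b, d] (fun i j hij => ?_) fun i j hij htw => ?_)
  · clear h
    fin_cases i <;> fin_cases j <;> first
      | exact absurd hij (by decide)
      | simp [F7, ofEdges, *]; done
      | simp_all [F7, ofEdges, G.adj_comm]
  · clear h
    fin_cases i <;> fin_cases j <;> first
      | exact absurd hij (by decide)
      | exact absurd htw (by simp only [F7]; decide)
      | simp_all

theorem f8_pattern (h : ¬ F8.IsIndContained G) {v a b c d z s t : V} :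
    G.Adj a b → G.Adj b c → G.Adj c d → G.Adj v a → G.Adj v b →
    G.Adj v c → G.Adj v d → G.Adj v z → G.Adj z s → G.Adj z t → G.Adj s t → ¬ G.Adj a c →
    ¬ G.Adj a d → ¬ G.Adj b d → ¬ G.Adj v s → ¬ G.Adj v t →
    (∀ i ∈ [a, b, c, d], ∀ j ∈ [z, s, t], ¬ G.Adj i j) → False := by
  intros
  simp only [List.forall_mem_cons, List.not_mem_nil, false_imp_iff, implies_true, and_true] at *
  refine h (isIndContained_of_lt ![a, b, c, d, v, z, s, t] (fun i j hij => ?_) fun i j hij htw => ?_)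
  · clear h
    fin_cases i <;> fin_cases j <;> first
      | exact absurd hij (by decide)
      | simp [F8, ofEdges, *]; done
      | simp_all [F8, ofEdges, G.adj_comm]
  · clear h
    fin_cases i <;> fin_cases j <;> first
      | exact absurd hij (by decide)
      | exact absurd htw (by simp only [F8]; decide)

theorem f9_pattern (h : ¬ F9.IsIndContained G) {v a x a' b y b' z s t : V} :
    G.Adj x a → G.Adj x a' → G.Adj y b → G.Adj y b' →
    (∀ i ∈ [a, x, a', b, y, b', z], G.Adj v i) → G.Adj z s → G.Adj z t → G.Adj s t →
    ¬ G.Adj a a' → ¬ G.Adj b b' → a ≠ a' → b ≠ b' → ¬ G.Adj v s → ¬ G.Adj v t →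
    (∀ i ∈ [a, x, a'], ∀ j ∈ [b, y, b'], ¬ G.Adj i j) →
    (∀ i ∈ [a, x, a', b, y, b'], ∀ j ∈ [z, s, t], ¬ G.Adj i j) → False := by
  intros
  simp only [List.forall_mem_cons, List.not_mem_nil, false_imp_iff, implies_true, and_true] at *
  refine h (isIndContained_of_lt ![a, x, a', b, y, b', v, z, s, t] (fun i j hij => ?_) fun i j hij htw => ?_)
  · clear h
    fin_cases i <;> fin_cases j <;> first
      | exact absurd hij (by decide)
      | simp [F9, ofEdges, *]; done
      | simp_all [F9, ofEdges, G.adj_comm]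
  · clear h
    fin_cases i <;> fin_cases j <;> first
      | exact absurd hij (by decide)
      | exact absurd htw (by simp only [F9]; decide)
      | simp_all

theorem f16_pattern (h : ¬ F16.IsIndContained G) {a b c d e f : V} :
    G.Adj a b → G.Adj b c → G.Adj c d → G.Adj d e → G.Adj e a →
    ¬ G.Adj a c → ¬ G.Adj a d → ¬ G.Adj b d → ¬ G.Adj b e → ¬ G.Adj c e →
    G.Adj f a → G.Adj f b → G.Adj f c → ¬ G.Adj f d → ¬ G.Adj f e → b ≠ f → False := by
  intros
  refine h (isIndContained_of_lt ![d, e, b, c, a, f] (fun i j hij => ?_) fun i j hij htw => ?_)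
  · clear h
    fin_cases i <;> fin_cases j <;> first
      | exact absurd hij (by decide)
      | simp [F16, ofEdges, *]; done
      | simp_all [F16, ofEdges, G.adj_comm]
  · clear h
    fin_cases i <;> fin_cases j <;> first
      | exact absurd hij (by decide)
      | exact absurd htw (by simp only [F16]; decide)

theorem patternFree_of_isFamilyFree (hF : IsFamilyFree familyF G)
    (hC4 : ¬ (SimpleGraph.cycleGraph 4).IsIndContained G) : PatternFree G where
  c4 := c4_pattern hC4
  p5 := p5_pattern (hF ⟨5, F1⟩ (by simp [familyF]))
  f2 := f2_pattern (hF ⟨7, F2⟩ (by simp [familyF]))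
  f3 := f3_pattern (hF ⟨9, F3⟩ (by simp [familyF]))
  f4 := f4_pattern (hF ⟨6, F4⟩ (by simp [familyF]))
  f5 := f5_pattern (hF ⟨7, F5⟩ (by simp [familyF]))
  f6 := f6_pattern (hF ⟨8, F6⟩ (by simp [familyF]))
  f7 := f7_pattern (hF ⟨8, F7⟩ (by simp [familyF]))
  f8 := f8_pattern (hF ⟨8, F8⟩ (by simp [familyF]))
  f9 := f9_pattern (hF ⟨10, F9⟩ (by simp [familyF]))
  f16 := f16_pattern (hF ⟨6, F16⟩ (by simp [familyF]))

/-! ### Domination and private neighbourhoods of non-adjacent vertices -/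

/-- Pattern-free graphs without induced `C₅`. -/
structure HolePatternFree (G : SimpleGraph V) : Prop extends PatternFree G where
  c5 : ∀ {a b c d e : V}, G.Adj a b → G.Adj b c → G.Adj c d → G.Adj d e → G.Adj e a →
    ¬ G.Adj a c → ¬ G.Adj a d → ¬ G.Adj b d → ¬ G.Adj b e → ¬ G.Adj c e → False

/-- `x` has two distinct non-adjacent neighbours. -/
def Nonsimplicial (G : SimpleGraph V) (x : V) : Prop :=
  ∃ a b, G.Adj x a ∧ G.Adj x b ∧ a ≠ b ∧ ¬ G.Adj a b

/-- Every common neighbour of `x` and `y` is adjacent to all other neighbours of `x`. -/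
def Dominates (G : SimpleGraph V) (x y : V) : Prop :=
  ∀ u, G.Adj x u → G.Adj y u → ∀ s, G.Adj x s → s ≠ u → G.Adj u s

/-- `x` has two distinct non-adjacent neighbours, neither of which is a neighbour of `y`. -/
def PrivatelyNonsimplicial (G : SimpleGraph V) (x y : V) : Prop :=
  ∃ a b, G.Adj x a ∧ G.Adj x b ∧ a ≠ b ∧ ¬ G.Adj a b ∧ ¬ G.Adj y a ∧ ¬ G.Adj y b

/-- If one vertex of a non-adjacent pair in the neighbourhood of `x` were also a neighbour of `y`,
domination would make it adjacent to the other. -/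
theorem Nonsimplicial.privately {x y : V} (hx : Nonsimplicial G x) (hd : Dominates G x y) :
    PrivatelyNonsimplicial G x y := by
  obtain ⟨a, b, ha, hb, hab, hn⟩ := hx
  refine ⟨a, b, ha, hb, hab, hn, fun hy => hn (hd a ha hy b hb hab.symm), fun hy => hn ?_⟩
  exact (hd b hb hy a ha hab).symm

theorem PatternFree.adj_of_common (h : PatternFree G) {x y u v : V} (hne : x ≠ y)
    (hxy : ¬ G.Adj x y) (hxu : G.Adj x u) (hyu : G.Adj y u) (hxv : G.Adj x v) (hyv : G.Adj y v)
    (huv : u ≠ v) : G.Adj u v := by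
  by_contra hc
  exact h.c4 hxu hyu.symm hyv hxv.symm hxy hc hne huv

namespace HolePatternFree

/-- Otherwise `x' x u y y'` induces P₅ or C₅. -/
theorem adj_or_adj_of_common (h : HolePatternFree G) {x y u x' y' : V} (hne : x ≠ y)
    (hxy : ¬ G.Adj x y) (hxu : G.Adj x u) (hyu : G.Adj y u) (hx : G.Adj x x') (hy : G.Adj y y')
    (hx'u : x' ≠ u) (hy'u : y' ≠ u) : G.Adj u x' ∨ G.Adj u y' := by
  by_contra! hc
  obtain ⟨h1, h2⟩ := hc
  have hyx' : ¬ G.Adj y x' := fun hy' => h1 (h.adj_of_common hne hxy hxu hyu hx hy' hx'u.symm)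
  have hxy' : ¬ G.Adj x y' := fun hx' => h2 (h.adj_of_common hne hxy hxu hyu hx' hy hy'u.symm)
  by_cases h3 : G.Adj x' y'
  · apply @h.c5 x' x u y y' <;> grind [G.adj_comm]
  · apply @h.p5 x' x u y y' <;> grind [G.adj_comm]

/-- Failure on both sides gives common neighbours `v`, `u` with non-neighbours `x'`, `y'`. The
preceding lemma then forces `u x'` and `v y'` to be edges, and the six vertices induce F₄. -/
theorem dominates_or_dominates (h : HolePatternFree G) {x y : V} (hne : x ≠ y)
    (hxy : ¬ G.Adj x y) : Dominates G x y ∨ Dominates G y x := by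
  by_contra! hc
  simp only [Dominates, not_forall] at hc
  obtain ⟨⟨v, hxv, hyv, x', hx, hx'v, hvx'⟩, u, hyu, hxu, y', hy, hy'u, huy'⟩ := hc
  have hK := fun {a b : V} => h.adj_of_common (u := a) (v := b) hne hxy
  have hO := fun {u x' y' : V} => h.adj_or_adj_of_common (u := u) (x' := x') (y' := y') hne hxy
  have h1 : x' ≠ u := by
    rintro rfl
    exact hvx' (hK hxv hyv hx hyu hx'v.symm)
  have h2 : y' ≠ v := by
    rintro rfl
    exact huy' (hK hxu hyu hxv hy hy'u.symm)
  have hux' : G.Adj u x' := (hO hxu hyu hx hy h1 hy'u).resolve_right huy'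
  have hvy' : G.Adj v y' := (hO hxv hyv hx hy hx'v h2).resolve_left hvx'
  have huv : u ≠ v := by
    rintro rfl
    exact hvx' hux'
  have huv' := hK hxu hyu hxv hyv huv
  have hyx' : ¬ G.Adj y x' := fun hy' => hvx' (hK hxv hyv hx hy' hx'v.symm)
  have hxy' : ¬ G.Adj x y' := fun hx' => huy' (hK hxu hyu hx' hy hy'u.symm)
  have hx'y' : ¬ G.Adj x' y' := fun hx'y' => by
    apply @h.c4 x' u v y' <;> grind [G.adj_comm]
  apply @h.f4 x' x u v y y' <;> grind [G.adj_comm]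

/-- The end of an edge between the private neighbourhoods of two non-adjacent vertices dominates
the neighbourhood of its centre. -/
theorem adj_of_private_edge (h : HolePatternFree G) {x y x' y' a : V}
    (hxy : ¬ G.Adj x y) (hx : G.Adj x x') (hyx' : ¬ G.Adj y x') (hy : G.Adj y y')
    (hxy' : ¬ G.Adj x y') (he : G.Adj x' y') (ha : G.Adj x a) (hax' : a ≠ x') : G.Adj x' a := by
  by_contra hc
  by_cases hya : G.Adj y a
  · by_cases h1 : G.Adj a y'
    · apply @h.c4 a x x' y' <;> grind [G.adj_comm]
    · apply @h.c5 x x' y' y a <;> grind [G.adj_comm]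
  · by_cases h1 : G.Adj a y'
    · apply @h.c4 a x x' y' <;> grind [G.adj_comm]
    · apply @h.p5 a x x' y' y <;> grind [G.adj_comm]

/-- The ends of an edge `s t` are complete to the rest of the neighbourhoods of `x` and `y`. Both
neighbourhoods contain non-adjacent pairs, and that of `x` is private by domination. If the pair at
`y` meets the neighbourhood of `x`, an F₄ appears; otherwise two diamonds joined by `s t` form F₇.
-/
theorem not_adj_private_of_dominates (h : HolePatternFree G) {x y s t : V} (hne : x ≠ y)
    (hxy : ¬ G.Adj x y) (hx : Nonsimplicial G x) (hy : Nonsimplicial G y) (hd : Dominates G x y)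
    (hs : G.Adj x s) (hys : ¬ G.Adj y s) (ht : G.Adj y t) (hxt : ¬ G.Adj x t) : ¬ G.Adj s t := by
  intro hst
  obtain ⟨a, a', ha, ha', hne_a, haa', hya, hya'⟩ := hx.privately hd
  have hyx : ¬ G.Adj y x := fun e => hxy e.symm
  have hX : ∀ {s t c}, G.Adj x s → ¬ G.Adj y s → G.Adj y t → ¬ G.Adj x t → G.Adj s t →
      G.Adj x c → c ≠ s → G.Adj s c := fun h1 h2 h3 h4 h5 h6 h7 =>
    h.adj_of_private_edge hxy h1 h2 h3 h4 h5 h6 h7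
  have hY : ∀ {s t c}, G.Adj x s → ¬ G.Adj y s → G.Adj y t → ¬ G.Adj x t → G.Adj s t →
      G.Adj y c → c ≠ t → G.Adj t c := fun h1 h2 h3 h4 h5 h6 h7 =>
    h.adj_of_private_edge hyx h3 h4 h1 h2 h5.symm h6 h7
  have hat : ∀ {t}, G.Adj y t → ¬ G.Adj x t → ¬ G.Adj a t := fun h1 h2 h3 =>
    haa' (hX ha hya h1 h2 h3 ha' hne_a.symm)
  have ha't : ∀ {t}, G.Adj y t → ¬ G.Adj x t → ¬ G.Adj a' t := fun h1 h2 h3 =>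
    haa' (hX ha' hya' h1 h2 h3 ha hne_a).symm
  have hsa : G.Adj s a := hX hs hys ht hxt hst ha (by rintro rfl; exact hat ht hxt hst)
  have hsa' : G.Adj s a' := hX hs hys ht hxt hst ha' (by rintro rfl; exact ha't ht hxt hst)
  have key : ∀ {b b'}, G.Adj y b → G.Adj y b' → b ≠ b' → ¬ G.Adj b b' → G.Adj x b → False := by
    intro b b' hb hb' hne_b hbb' hxb
    have hxb' : ¬ G.Adj x b' := fun e => hbb' (h.adj_of_common hne hxy hxb hb e hb' hne_b)
    have hb't : b' ≠ t := by
      rintro rfl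
      exact hbb' (hY hs hys ht hxt hst hb hne_b).symm
    have htb' := hY hs hys ht hxt hst hb' hb't
    have htb := hY hs hys ht hxt hst hb (by rintro rfl; exact hxt hxb)
    have hsb := hX hs hys ht hxt hst hxb (by rintro rfl; exact hys hb)
    have hba := hd b hxb hb a ha (by rintro rfl; exact hya hb)
    have hsb' : ¬ G.Adj s b' := fun e => hbb' (hY hs hys hb' hxb' e hb hne_b).symm
    have h1 := hat hb' hxb'
    have h2 := hat ht hxt
    apply @h.f4 a s b t y b' <;> grind [G.adj_comm]
  obtain ⟨b, b', hb, hb', hne_b, hbb'⟩ := hy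
  have hxb : ¬ G.Adj x b := fun e => key hb hb' hne_b hbb' e
  have hxb' : ¬ G.Adj x b' := fun e => key hb' hb hne_b.symm (fun e => hbb' e.symm) e
  have hbs : ¬ G.Adj s b := fun e => hbb' (hY hs hys hb hxb e hb' hne_b.symm)
  have hbs' : ¬ G.Adj s b' := fun e => hbb' (hY hs hys hb' hxb' e hb hne_b).symm
  have htb := hY hs hys ht hxt hst hb (by rintro rfl; exact hbs hst)
  have htb' := hY hs hys ht hxt hst hb' (by rintro rfl; exact hbs' hst)
  have h1 := hat hb hxb
  have h2 := hat hb' hxb'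
  have h3 := hat ht hxt
  have h4 := ha't hb hxb
  have h5 := ha't hb' hxb'
  have h6 := ha't ht hxt
  clear hX hY hat ha't key
  apply @h.f7 a x s a' b t y b' <;>
    (try simp only [List.forall_mem_cons, List.not_mem_nil, false_imp_iff, implies_true, and_true])
    <;> grind [G.adj_comm]

/-- The private neighbourhoods of two non-adjacent non-simplicial vertices are anticomplete. -/
theorem not_adj_private (h : HolePatternFree G) {x y s t : V} (hne : x ≠ y)
    (hxy : ¬ G.Adj x y) (hx : Nonsimplicial G x) (hy : Nonsimplicial G y)
    (hs : G.Adj x s) (hys : ¬ G.Adj y s) (ht : G.Adj y t) (hxt : ¬ G.Adj x t) : ¬ G.Adj s t := by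
  rcases h.dominates_or_dominates hne hxy with hd | hd
  · exact h.not_adj_private_of_dominates hne hxy hx hy hd hs hys ht hxt
  · exact fun e => h.not_adj_private_of_dominates hne.symm (fun e => hxy e.symm) hy hx hd ht hxt
      hs hys e.symm

/-- Otherwise the triangles `u y t`, `y t w` and the diamond formed by `u`, `x` and a private
non-adjacent pair at `x` share only `u` and induce F₅. -/
theorem adj_of_dominates (h : HolePatternFree G) {x y u t w : V} (hne : x ≠ y)
    (hxy : ¬ G.Adj x y) (hx : Nonsimplicial G x) (hy : Nonsimplicial G y) (hd : Dominates G x y)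
    (hxu : G.Adj x u) (hyu : G.Adj y u) (ht : G.Adj y t) (hxt : ¬ G.Adj x t) (hw : G.Adj y w)
    (hxw : ¬ G.Adj x w) (htw : G.Adj t w) (hut : G.Adj u t) : G.Adj u w := by
  by_contra hc
  obtain ⟨a, a', ha, ha', hne_a, haa', hya, hya'⟩ := hx.privately hd
  have hD := fun {s t : V} => h.not_adj_private (s := s) (t := t) hne hxy hx hy
  have hua := hd u hxu hyu a ha (by rintro rfl; exact hya hyu)
  have hua' := hd u hxu hyu a' ha' (by rintro rfl; exact hya' hyu)
  have h1 := hD ha hya ht hxt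
  have h2 := hD ha hya hw hxw
  have h3 := hD ha' hya' ht hxt
  have h4 := hD ha' hya' hw hxw
  apply @h.f5 u y t w x a a' <;> grind [G.adj_comm]

/-- If the private neighbours of `y` form a clique, a non-adjacent pair at `y` has an end `b`
adjacent to `x` and a private end `b'`. By `adj_of_dominates`, an edge from `b` to any private
neighbour of `y` would force the edge `b b'`, so `b` serves as `u`. -/
theorem privatelyNonsimplicial_or (h : HolePatternFree G) {x y : V} (hne : x ≠ y)
    (hxy : ¬ G.Adj x y) (hx : Nonsimplicial G x) (hy : Nonsimplicial G y) (hd : Dominates G x y) :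
    PrivatelyNonsimplicial G y x ∨
      (∀ s t, G.Adj y s → ¬ G.Adj x s → G.Adj y t → ¬ G.Adj x t → s ≠ t → G.Adj s t) ∧
      ∃ u, G.Adj x u ∧ G.Adj y u ∧ ∀ t, G.Adj y t → ¬ G.Adj x t → ¬ G.Adj u t := by
  by_cases hp : PrivatelyNonsimplicial G y x
  · exact .inl hp
  have hcl : ∀ s t, G.Adj y s → ¬ G.Adj x s → G.Adj y t → ¬ G.Adj x t → s ≠ t → G.Adj s t := by
    intro s t hs hxs ht hxt hst
    by_contra hc
    exact hp ⟨s, t, hs, ht, hst, hc, hxs, hxt⟩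
  refine .inr ⟨hcl, ?_⟩
  have key : ∀ {b b'}, G.Adj y b → G.Adj y b' → b ≠ b' → ¬ G.Adj b b' → G.Adj x b →
      ∃ u, G.Adj x u ∧ G.Adj y u ∧ ∀ t, G.Adj y t → ¬ G.Adj x t → ¬ G.Adj u t := by
    intro b b' hb hb' hne_b hbb' hxb
    have hxb' : ¬ G.Adj x b' := fun e => hbb' (h.adj_of_common hne hxy hxb hb e hb' hne_b)
    refine ⟨b, hxb, hb, fun t ht hxt hbt => ?_⟩
    have htb' : t ≠ b' := by
      rintro rfl
      exact hbb' hbt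
    exact hbb' (h.adj_of_dominates hne hxy hx hy hd hxb hb ht hxt hb' hxb'
      (hcl t b' ht hxt hb' hxb' htb') hbt)
  obtain ⟨b, b', hb, hb', hne_b, hbb'⟩ := hy
  by_cases hxb : G.Adj x b
  · exact key hb hb' hne_b hbb' hxb
  · by_cases hxb' : G.Adj x b'
    · exact key hb' hb hne_b.symm (fun e => hbb' e.symm) hxb'
    · exact absurd (hcl b b' hb hxb hb' hxb' hne_b) hbb'


/-! ### Three pairwise non-adjacent b-vertices -/

/-- If `x` and `y` have non-simplicial neighbourhoods outside those of the other two vertices, then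
all but one of the neighbours of `z` are common neighbours of `x` and `y`. -/
theorem false_of_two_private (h : HolePatternFree G) {x y z a a' b b' z₁ z₂ : V}
    (hxy : x ≠ y) (hxz : x ≠ z) (hyz : y ≠ z)
    (nxy : ¬ G.Adj x y) (nxz : ¬ G.Adj x z) (nyz : ¬ G.Adj y z)
    (hx : Nonsimplicial G x) (hy : Nonsimplicial G y) (hz : Nonsimplicial G z)
    (dxz : Dominates G x z) (dyz : Dominates G y z)
    (xa : G.Adj x a) (xa' : G.Adj x a') (naa' : ¬ G.Adj a a') (haa' : a ≠ a')
    (nya : ¬ G.Adj y a) (nya' : ¬ G.Adj y a') (nza : ¬ G.Adj z a) (nza' : ¬ G.Adj z a')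
    (yb : G.Adj y b) (yb' : G.Adj y b') (nbb' : ¬ G.Adj b b') (hbb' : b ≠ b')
    (nxb : ¬ G.Adj x b) (nxb' : ¬ G.Adj x b') (nzb : ¬ G.Adj z b) (nzb' : ¬ G.Adj z b')
    (hz₁ : G.Adj z z₁) (hxz₁ : ¬ G.Adj x z₁) (hz₂ : G.Adj z z₂) (hyz₂ : ¬ G.Adj y z₂)
    (hzz : z₁ ≠ z₂) : False := by
  have Dxy := fun {s t : V} => h.not_adj_private (s := s) (t := t) hxy nxy hx hy
  have Dxz := fun {s t : V} => h.not_adj_private (s := s) (t := t) hxz nxz hx hz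
  have Dyz := fun {s t : V} => h.not_adj_private (s := s) (t := t) hyz nyz hy hz
  have ab := Dxy xa nya yb nxb
  have ab' := Dxy xa nya yb' nxb'
  have a'b := Dxy xa' nya' yb nxb
  have a'b' := Dxy xa' nya' yb' nxb'
  -- a common neighbour of `x`, `z` with a private non-neighbour at `z` is adjacent to `y`
  have key : ∀ {u w}, G.Adj x u → G.Adj z u → G.Adj z w → ¬ G.Adj x w → ¬ G.Adj u w →
      G.Adj y u := by
    intro u w xu zu zw nxw nuw
    by_contra nyu
    have ua := dxz u xu zu a xa (by rintro rfl; exact nza zu)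
    have ua' := dxz u xu zu a' xa' (by rintro rfl; exact nza' zu)
    have ub := Dxy xu nyu yb nxb
    have ub' := Dxy xu nyu yb' nxb'
    by_cases yw : G.Adj y w
    · have wb := dyz w yw zw b yb (by rintro rfl; exact nzb zw)
      have wb' := dyz w yw zw b' yb' (by rintro rfl; exact nzb' zw)
      have aw := Dxy xa nya yw nxw
      have a'w := Dxy xa' nya' yw nxw
      clear Dxy Dxz Dyz
      apply @h.f6 a x u a' b y w b' <;>
        (try simp only [List.forall_mem_cons, List.not_mem_nil, false_imp_iff, implies_true,
          and_true]) <;> grind [G.adj_comm]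
    · have bw := Dyz yb nzb zw yw
      have b'w := Dyz yb' nzb' zw yw
      clear Dxy Dxz Dyz
      apply @h.f2 x u z w b y b' <;>
        (try simp only [List.forall_mem_cons, List.not_mem_nil, false_imp_iff, implies_true,
          and_true]) <;> grind [G.adj_comm]
  have key' : ∀ {u w}, G.Adj y u → G.Adj z u → G.Adj z w → ¬ G.Adj y w → ¬ G.Adj u w →
      G.Adj x u := by
    intro u w yu zu zw nyw nuw
    by_contra nxu
    have ub := dyz u yu zu b yb (by rintro rfl; exact nzb zu)
    have ub' := dyz u yu zu b' yb' (by rintro rfl; exact nzb' zu)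
    have au := Dxy xa nya yu nxu
    have a'u := Dxy xa' nya' yu nxu
    by_cases xw : G.Adj x w
    · have wa := dxz w xw zw a xa (by rintro rfl; exact nza zw)
      have wa' := dxz w xw zw a' xa' (by rintro rfl; exact nza' zw)
      have wb := Dxy xw nyw yb nxb
      have wb' := Dxy xw nyw yb' nxb'
      clear Dxy Dxz Dyz
      apply @h.f6 a x w a' b y u b' <;>
        (try simp only [List.forall_mem_cons, List.not_mem_nil, false_imp_iff, implies_true,
          and_true]) <;> grind [G.adj_comm]
    · have aw := Dxz xa nza zw xw
      have a'w := Dxz xa' nza' zw xw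
      clear Dxy Dxz Dyz
      apply @h.f2 y u z w a x a' <;>
        (try simp only [List.forall_mem_cons, List.not_mem_nil, false_imp_iff, implies_true,
          and_true]) <;> grind [G.adj_comm]
  -- no induced path centred at `z` avoids the neighbourhoods of both `x` and `y`
  have hP : ∀ {c c'}, G.Adj z c → G.Adj z c' → c ≠ c' → ¬ G.Adj c c' → ¬ G.Adj x c →
      ¬ G.Adj y c → ¬ G.Adj x c' → ¬ G.Adj y c' → False := by
    intro c c' zc zc' hcc' ncc' nxc nyc nxc' nyc'
    have ac := Dxz xa nza zc nxc
    have a'c := Dxz xa' nza' zc nxc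
    have ac' := Dxz xa nza zc' nxc'
    have a'c' := Dxz xa' nza' zc' nxc'
    have bc := Dyz yb nzb zc nyc
    have b'c := Dyz yb' nzb' zc nyc
    have bc' := Dyz yb nzb zc' nyc'
    have b'c' := Dyz yb' nzb' zc' nyc'
    clear Dxy Dxz Dyz key key'
    apply @h.f3 a x a' b y b' c z c' <;>
      (try simp only [List.forall_mem_cons, List.not_mem_nil, false_imp_iff, implies_true,
        and_true]) <;> grind [G.adj_comm]
  -- By `hP`, one end of a non-adjacent pair at `z` is seen by `x` or `y`. Then `key` and `key'`
  -- make that end a common neighbour of all three, while C₄-freeness keeps the other end away from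
  -- `x` and `y`.
  obtain ⟨u, w, zu, zw, huw, nuw, xu, yu, nxw, nyw⟩ : ∃ u w, G.Adj z u ∧ G.Adj z w ∧ u ≠ w ∧
      ¬ G.Adj u w ∧ G.Adj x u ∧ G.Adj y u ∧ ¬ G.Adj x w ∧ ¬ G.Adj y w := by
    have aux : ∀ {c c'}, G.Adj z c → G.Adj z c' → c ≠ c' → ¬ G.Adj c c' →
        G.Adj x c ∨ G.Adj y c → ∃ u w, G.Adj z u ∧ G.Adj z w ∧ u ≠ w ∧
        ¬ G.Adj u w ∧ G.Adj x u ∧ G.Adj y u ∧ ¬ G.Adj x w ∧ ¬ G.Adj y w := by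
      intro c c' zc zc' hcc' ncc' hc
      have h1 : G.Adj x c → ¬ G.Adj x c' := fun e e' =>
        ncc' (h.adj_of_common hxz nxz e zc e' zc' hcc')
      have h2 : G.Adj y c → ¬ G.Adj y c' := fun e e' =>
        ncc' (h.adj_of_common hyz nyz e zc e' zc' hcc')
      have xc : G.Adj x c := hc.elim id fun e => key' e zc zc' (h2 e) ncc'
      have yc : G.Adj y c := hc.elim (fun e => key e zc zc' (h1 e) ncc') id
      exact ⟨c, c', zc, zc', hcc', ncc', xc, yc, h1 xc, h2 yc⟩
    obtain ⟨c, c', zc, zc', hcc', ncc'⟩ := hz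
    by_cases h1 : G.Adj x c ∨ G.Adj y c
    · exact aux zc zc' hcc' ncc' h1
    · by_cases h2 : G.Adj x c' ∨ G.Adj y c'
      · exact aux zc' zc hcc'.symm (fun e => ncc' e.symm) h2
      · push Not at h1 h2
        exact (hP zc zc' hcc' ncc' h1.1 h1.2 h2.1 h2.2).elim
  have ua := dxz u xu zu a xa (by rintro rfl; exact nza zu)
  have ua' := dxz u xu zu a' xa' (by rintro rfl; exact nza' zu)
  have ub := dyz u yu zu b yb (by rintro rfl; exact nzb zu)
  have ub' := dyz u yu zu b' yb' (by rintro rfl; exact nzb' zu)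
  have aw := Dxz xa nza zw nxw
  have a'w := Dxz xa' nza' zw nxw
  have bw := Dyz yb nzb zw nyw
  have b'w := Dyz yb' nzb' zw nyw
  -- If `t w` is an edge, a `t` violating the claim yields F₅ when `t u` is an edge and F₉ when it
  -- is not. If `t w` is a non-edge, `hP` and the two `key` facts apply to the pair `t`, `w`.
  have hall : ∀ t, G.Adj z t → t ≠ w → G.Adj x t ∧ G.Adj y t := by
    intro t zt htw
    by_cases hut : u = t
    · exact hut ▸ ⟨xu, yu⟩
    by_cases ntw : G.Adj t w
    · by_cases tu : G.Adj t u
      · constructor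
        · by_contra nxt
          have h1 := Dxz xa nza zt nxt
          have h2 := Dxz xa' nza' zt nxt
          clear Dxy Dxz Dyz key key' hP
          apply @h.f5 u z t w x a a' <;>
            (try simp only [List.forall_mem_cons, List.not_mem_nil, false_imp_iff, implies_true,
              and_true]) <;> grind [G.adj_comm]
        · by_contra nyt
          have h1 := Dyz yb nzb zt nyt
          have h2 := Dyz yb' nzb' zt nyt
          clear Dxy Dxz Dyz key key' hP
          apply @h.f5 u z t w y b b' <;>
            (try simp only [List.forall_mem_cons, List.not_mem_nil, false_imp_iff, implies_true,
              and_true]) <;> grind [G.adj_comm]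
      · have nxt : ¬ G.Adj x t := fun e => tu (h.adj_of_common hxz nxz xu zu e zt hut).symm
        have nyt : ¬ G.Adj y t := fun e => tu (h.adj_of_common hyz nyz yu zu e zt hut).symm
        have h1 := Dxz xa nza zt nxt
        have h2 := Dxz xa' nza' zt nxt
        have h3 := Dyz yb nzb zt nyt
        have h4 := Dyz yb' nzb' zt nyt
        clear Dxy Dxz Dyz key key' hP
        refine (@h.f9 u a x a' b y b' z t w ?_ ?_ ?_ ?_ ?_ ?_ ?_ ?_ ?_ ?_ ?_ ?_ ?_ ?_ ?_ ?_).elim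
          <;> (try simp only [List.forall_mem_cons, List.not_mem_nil, false_imp_iff, implies_true,
            and_true]) <;> grind [G.adj_comm]
    · by_cases hc : G.Adj x t ∨ G.Adj y t
      · rcases hc with xt | yt
        · exact ⟨xt, key xt zt zw nxw ntw⟩
        · exact ⟨key' yt zt zw nyw ntw, yt⟩
      · push Not at hc
        exact (hP zt zw htw ntw hc.1 hc.2 nxw nyw).elim
  have e1 : z₁ = w := by
    by_contra hc
    exact hxz₁ (hall _ hz₁ hc).1
  have e2 : z₂ = w := by
    by_contra hc
    exact hyz₂ (hall _ hz₂ hc).2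
  exact hzz (e1.trans e2.symm)

/-- Three pairwise non-adjacent vertices cannot dominate each other transitively. -/
theorem false_of_dominates_transitive (h : HolePatternFree G) {x y z y₁ z₁ z₂ : V}
    (hxy : x ≠ y) (hxz : x ≠ z) (hyz : y ≠ z)
    (nxy : ¬ G.Adj x y) (nxz : ¬ G.Adj x z) (nyz : ¬ G.Adj y z)
    (hx : Nonsimplicial G x) (hy : Nonsimplicial G y) (hz : Nonsimplicial G z)
    (dxy : Dominates G x y) (dxz : Dominates G x z) (dyz : Dominates G y z)
    (hy₁ : G.Adj y y₁) (hxy₁ : ¬ G.Adj x y₁)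
    (hz₁ : G.Adj z z₁) (hxz₁ : ¬ G.Adj x z₁) (hz₂ : G.Adj z z₂) (hyz₂ : ¬ G.Adj y z₂)
    (hzz : z₁ ≠ z₂) : False := by
  have Dxy := fun {s t : V} => h.not_adj_private (s := s) (t := t) hxy nxy hx hy
  have Dxz := fun {s t : V} => h.not_adj_private (s := s) (t := t) hxz nxz hx hz
  have Dyz := fun {s t : V} => h.not_adj_private (s := s) (t := t) hyz nyz hy hz
  rcases h.privatelyNonsimplicial_or hxy nxy hx hy dxy with hp | ⟨hY, u, xu, yu, hu⟩
  · obtain ⟨b, b', yb, yb', hbb', nbb', nxb, nxb'⟩ := hp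
    obtain ⟨a, a', xa, xa', haa', naa'⟩ := id hx
    exact h.false_of_two_private hxy hxz hyz nxy nxz nyz hx hy hz dxz dyz xa xa' naa' haa'
      (fun e => naa' (dxy a xa e a' xa' haa'.symm))
      (fun e => naa' (dxy a' xa' e a xa haa').symm)
      (fun e => naa' (dxz a xa e a' xa' haa'.symm))
      (fun e => naa' (dxz a' xa' e a xa haa').symm) yb yb' nbb' hbb' nxb nxb'
      (fun e => nbb' (dyz b yb e b' yb' hbb'.symm))
      (fun e => nbb' (dyz b' yb' e b yb hbb').symm) hz₁ hxz₁ hz₂ hyz₂ hzz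
  -- Now `y₁ y u x` is an induced path. The facts `hK` and `hyu` below show that `x` and `y` have
  -- the same neighbours among those of `z`. The path then gives F₂ with a private P₃ at `z`, or F₈
  -- with a triangle at `z` attached through a common neighbour `v`.
  have nuy₁ := hu y₁ hy₁ hxy₁
  have hne : y₁ ≠ u := by
    rintro rfl
    exact hxy₁ xu
  have hK : ∀ {v}, G.Adj y v → G.Adj z v → G.Adj x v := by
    intro v yv zv
    by_contra nxv
    exact hu v yv nxv (dyz v yv zv u yu (by rintro rfl; exact nxv xu)).symm
  have nzu : ¬ G.Adj z u := fun e => nuy₁ (dyz u yu e y₁ hy₁ hne)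
  have nzy₁ : ¬ G.Adj z y₁ := fun e => hxy₁ (hK hy₁ e)
  have hyu : ∀ {v}, G.Adj x v → G.Adj z v → G.Adj y v := by
    intro v xv zv
    by_contra nyv
    have uv := dxy u xu yu v xv (by rintro rfl; exact nyv yu)
    have h1 := Dxy xv nyv hy₁ hxy₁
    clear Dxy Dxz Dyz hY hu hK
    apply @h.p5 y₁ y u v z <;> grind [G.adj_comm]
  rcases h.privatelyNonsimplicial_or hxz nxz hx hz dxz with hp | ⟨hZ, v, xv, zv, hv⟩
  · obtain ⟨c, c', zc, zc', hcc', ncc', nxc, nxc'⟩ := hp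
    have nyc : ¬ G.Adj y c := fun e => nxc (hK e zc)
    have nyc' : ¬ G.Adj y c' := fun e => nxc' (hK e zc')
    have h1 := Dyz hy₁ nzy₁ zc nyc
    have h2 := Dyz hy₁ nzy₁ zc' nyc'
    have h3 := Dxz xu nzu zc nxc
    have h4 := Dxz xu nzu zc' nxc'
    clear Dxy Dxz Dyz hY hu hK hyu
    apply @h.f2 y₁ y u x c z c' <;>
      (try simp only [List.forall_mem_cons, List.not_mem_nil, false_imp_iff, implies_true,
        and_true]) <;> grind [G.adj_comm]
  · have nxz₂ : ¬ G.Adj x z₂ := fun e => hyz₂ (hyu e hz₂)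
    have nyz₁ : ¬ G.Adj y z₁ := fun e => hxz₁ (hK e hz₁)
    have zz := hZ z₁ z₂ hz₁ hxz₁ hz₂ nxz₂ hzz
    have yv := hyu xv zv
    have h1 := dyz v yv zv y₁ hy₁ (by rintro rfl; exact hxy₁ xv)
    have h2 := dyz v yv zv u yu (by rintro rfl; exact nzu zv)
    have h3 := hv z₁ hz₁ hxz₁
    have h4 := hv z₂ hz₂ nxz₂
    have h5 := Dxz xu nzu hz₁ hxz₁
    have h6 := Dxz xu nzu hz₂ nxz₂
    have h7 := Dyz hy₁ nzy₁ hz₁ nyz₁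
    have h8 := Dyz hy₁ nzy₁ hz₂ hyz₂
    clear Dxy Dxz Dyz hY hu hK hyu hZ hv
    apply @h.f8 v x u y y₁ z z₁ z₂ <;>
      (try simp only [List.forall_mem_cons, List.not_mem_nil, false_imp_iff, implies_true,
        and_true]) <;> grind [G.adj_comm]

/-- Failure of the two dominations supplies `u`, a common neighbour of `x` and `y` missing some
neighbour `w` of `y`, and `t`, a common neighbour of `x` and `z`. Then `w y u t z` is an induced P₅.
-/
theorem false_of_dominates_cyclic (h : HolePatternFree G) {x y z : V}
    (hxy : x ≠ y) (nxy : ¬ G.Adj x y) (nyz : ¬ G.Adj y z)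
    (hx : Nonsimplicial G x) (hy : Nonsimplicial G y)
    (dxy : Dominates G x y) (dyz : Dominates G y z)
    (nyx : ¬ Dominates G y x) (nxz : ¬ Dominates G x z) : False := by
  have Dxy := fun {s t : V} => h.not_adj_private (s := s) (t := t) hxy nxy hx hy
  simp only [Dominates, not_forall] at nyx nxz
  obtain ⟨u, yu, xu, w, yw, hwu, nuw⟩ := nyx
  obtain ⟨t, xt, zt, r, xr, hrt, ntr⟩ := nxz
  have nxw : ¬ G.Adj x w := fun e => nuw (h.adj_of_common hxy nxy xu yu e yw hwu.symm)
  have nyt : ¬ G.Adj y t := fun e => ntr (dxy t xt e r xr hrt)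
  have nzu : ¬ G.Adj z u := fun e => nuw (dyz u yu e w yw hwu)
  have ut := dxy u xu yu t xt (by rintro rfl; exact nyt yu)
  have nzw : ¬ G.Adj z w := fun e => nuw (dyz w yw e u yu hwu.symm).symm
  have tw := Dxy xt nyt yw nxw
  clear Dxy dxy dyz
  apply @h.p5 w y u t z <;> grind [G.adj_comm]

/-- Domination orients each pair. Either some orientation of the three pairs is transitive, or the
only possibility is a cycle with no reverse domination. -/
theorem false_of_dominates (h : HolePatternFree G) {x y z x₁ x₂ y₁ y₂ z₁ z₂ : V}
    (hxy : x ≠ y) (hxz : x ≠ z) (hyz : y ≠ z)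
    (nxy : ¬ G.Adj x y) (nxz : ¬ G.Adj x z) (nyz : ¬ G.Adj y z)
    (hx : Nonsimplicial G x) (hy : Nonsimplicial G y) (hz : Nonsimplicial G z)
    (hx₁ : G.Adj x x₁) (hyx₁ : ¬ G.Adj y x₁) (hx₂ : G.Adj x x₂) (hzx₂ : ¬ G.Adj z x₂)
    (hxx : x₁ ≠ x₂)
    (hy₁ : G.Adj y y₁) (hxy₁ : ¬ G.Adj x y₁) (hy₂ : G.Adj y y₂) (hzy₂ : ¬ G.Adj z y₂)
    (hyy : y₁ ≠ y₂)
    (hz₁ : G.Adj z z₁) (hxz₁ : ¬ G.Adj x z₁) (hz₂ : G.Adj z z₂) (hyz₂ : ¬ G.Adj y z₂)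
    (hzz : z₁ ≠ z₂) (dxy : Dominates G x y) : False := by
  have nyx : ¬ G.Adj y x := fun e => nxy e.symm
  have nzx : ¬ G.Adj z x := fun e => nxz e.symm
  have nzy : ¬ G.Adj z y := fun e => nyz e.symm
  by_cases dxz : Dominates G x z
  · rcases h.dominates_or_dominates hyz nyz with dyz | dzy
    · exact h.false_of_dominates_transitive hxy hxz hyz nxy nxz nyz hx hy hz dxy dxz dyz
        hy₁ hxy₁ hz₁ hxz₁ hz₂ hyz₂ hzz
    · exact h.false_of_dominates_transitive hxz hxy hyz.symm nxz nxy nzy hx hz hy dxz dxy dzy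
        hz₁ hxz₁ hy₁ hxy₁ hy₂ hzy₂ hyy
  have dzx := (h.dominates_or_dominates hxz nxz).resolve_left dxz
  by_cases dzy : Dominates G z y
  · exact h.false_of_dominates_transitive hxz.symm hyz.symm hxy nzx nzy nxy hz hx hy dzx dzy dxy
      hx₂ hzx₂ hy₂ hzy₂ hy₁ hxy₁ hyy.symm
  have dyz := (h.dominates_or_dominates hyz nyz).resolve_right dzy
  by_cases dyx : Dominates G y x
  · exact h.false_of_dominates_transitive hyz hxy.symm hxz.symm nyz nyx nzx hy hz hx dyz dyx dzx
      hz₂ hyz₂ hx₁ hyx₁ hx₂ hzx₂ hxx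
  · exact h.false_of_dominates_cyclic hxy nxy nyz hx hy dxy dyz dyx dxz


/-- The auxiliary vertices come from the b-coloring: each of `x`, `y`, `z` has a neighbour in the
color of each of the other two. Such a neighbour is not adjacent to the vertex whose color it
shares, and the two colors differ. -/
theorem false_of_independent_triple (h : HolePatternFree G) {x y z x₁ x₂ y₁ y₂ z₁ z₂ : V}
    (hxy : x ≠ y) (hxz : x ≠ z) (hyz : y ≠ z)
    (nxy : ¬ G.Adj x y) (nxz : ¬ G.Adj x z) (nyz : ¬ G.Adj y z)
    (hx : Nonsimplicial G x) (hy : Nonsimplicial G y) (hz : Nonsimplicial G z)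
    (hx₁ : G.Adj x x₁) (hyx₁ : ¬ G.Adj y x₁) (hx₂ : G.Adj x x₂) (hzx₂ : ¬ G.Adj z x₂)
    (hxx : x₁ ≠ x₂)
    (hy₁ : G.Adj y y₁) (hxy₁ : ¬ G.Adj x y₁) (hy₂ : G.Adj y y₂) (hzy₂ : ¬ G.Adj z y₂)
    (hyy : y₁ ≠ y₂)
    (hz₁ : G.Adj z z₁) (hxz₁ : ¬ G.Adj x z₁) (hz₂ : G.Adj z z₂) (hyz₂ : ¬ G.Adj y z₂)
    (hzz : z₁ ≠ z₂) : False := by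
  rcases h.dominates_or_dominates hxy nxy with d | d
  · exact h.false_of_dominates hxy hxz hyz nxy nxz nyz hx hy hz hx₁ hyx₁ hx₂ hzx₂ hxx
      hy₁ hxy₁ hy₂ hzy₂ hyy hz₁ hxz₁ hz₂ hyz₂ hzz d
  · exact h.false_of_dominates hxy.symm hyz hxz (fun e => nxy e.symm) nyz nxz hy hx hz
      hy₁ hxy₁ hy₂ hzy₂ hyy hx₁ hyx₁ hx₂ hzx₂ hxx hz₂ hyz₂ hz₁ hxz₁ hzz.symm d

/-! ### Two disjoint non-adjacent pairs of b-vertices -/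

/-- An induced path on four vertices has a simplicial end. -/
theorem false_of_nonsimplicial_path (h : HolePatternFree G) {z x w y : V}
    (zx : G.Adj z x) (xw : G.Adj x w) (wy : G.Adj w y)
    (nxy : ¬ G.Adj x y) (nzw : ¬ G.Adj z w) (nyz : ¬ G.Adj y z)
    (hz : Nonsimplicial G z) (hy : Nonsimplicial G y) : False := by
  have hxy : x ≠ y := by
    rintro rfl
    exact nyz zx.symm
  have hzw : z ≠ w := by
    rintro rfl
    exact nyz wy.symm
  have hzy : z ≠ y := by
    rintro rfl
    exact nxy zx.symm
  have nzy : ¬ G.Adj z y := fun e => nyz e.symm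
  -- A middle vertex cannot dominate the end it misses, since this would add a chord to the path. So
  -- the ends dominate and carry private non-adjacent pairs, which complete two diamonds joined by
  -- `x w`, that is, F₇.
  have dyx : Dominates G y x := (h.dominates_or_dominates hxy nxy).resolve_left fun d =>
    nzw (d w xw wy.symm z zx.symm hzw).symm
  have dzw : Dominates G z w := (h.dominates_or_dominates hzw nzw).resolve_right fun d =>
    nxy (d x xw.symm zx y wy hxy.symm)
  obtain ⟨c, c', zc, zc', hcc', ncc', nwc, nwc'⟩ := hz.privately dzw
  obtain ⟨b, b', yb, yb', hbb', nbb', nxb, nxb'⟩ := hy.privately dyx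
  have xc := dzw x zx xw.symm c zc (by rintro rfl; exact nwc xw.symm)
  have xc' := dzw x zx xw.symm c' zc' (by rintro rfl; exact nwc' xw.symm)
  have wb := dyx w wy.symm xw b yb (by rintro rfl; exact nxb xw)
  have wb' := dyx w wy.symm xw b' yb' (by rintro rfl; exact nxb' xw)
  have hwc : ∀ {c}, ¬ G.Adj w c → G.Adj x c → G.Adj z c → ¬ G.Adj y c := by
    intro c nwc xc zc yc
    exact nwc (h.adj_of_common hxy nxy xw wy.symm xc yc (by rintro rfl; exact nzw zc))
  have nyc := hwc nwc xc zc
  have nyc' := hwc nwc' xc' zc'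
  have nzb : ¬ G.Adj z b := fun e => nxb ((dzw b e wb x zx (by rintro rfl; exact nxy yb.symm)).symm)
  have nzb' : ¬ G.Adj z b' := fun e =>
    nxb' ((dzw b' e wb' x zx (by rintro rfl; exact nxy yb'.symm)).symm)
  have D := fun {s t : V} => h.not_adj_private (s := s) (t := t) hzy nzy hz hy
  have h1 := D zc nyc yb nzb
  have h2 := D zc nyc yb' nzb'
  have h3 := D zc' nyc' yb nzb
  have h4 := D zc' nyc' yb' nzb'
  clear D hwc dyx dzw
  apply @h.f7 c z x c' b w y b' <;>
    (try simp only [List.forall_mem_cons, List.not_mem_nil, false_imp_iff, implies_true,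
      and_true]) <;> grind [G.adj_comm]

/-- An edge with non-simplicial ends is the middle of a diamond or of a path on four vertices. -/
theorem diamond_or_path (h : HolePatternFree G) (P : V → Prop) {x z a a' c c' : V}
    (xz : G.Adj x z) (Pa : P a) (Pa' : P a') (Pc : P c) (Pc' : P c')
    (xa : G.Adj x a) (xa' : G.Adj x a') (haa' : a ≠ a') (naa' : ¬ G.Adj a a')
    (zc : G.Adj z c) (zc' : G.Adj z c') (hcc' : c ≠ c') (ncc' : ¬ G.Adj c c') :
    (∃ p q, P p ∧ P q ∧ G.Adj x p ∧ G.Adj x q ∧ G.Adj z p ∧ G.Adj z q ∧ p ≠ q ∧ ¬ G.Adj p q) ∨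
    ∃ p q, P p ∧ P q ∧ G.Adj x p ∧ G.Adj z q ∧ ¬ G.Adj z p ∧ ¬ G.Adj x q ∧ ¬ G.Adj p q := by
  have aux : ∀ {x z a a'}, G.Adj x z → P a → P a' → G.Adj x a → G.Adj x a' → a ≠ a' →
      ¬ G.Adj a a' → (G.Adj z a ∧ G.Adj z a') ∨ ∃ p, P p ∧ G.Adj x p ∧ p ≠ z ∧ ¬ G.Adj z p := by
    intro x z a a' xz Pa Pa' xa xa' haa' naa'
    by_cases za : G.Adj z a
    · by_cases za' : G.Adj z a'
      · exact .inl ⟨za, za'⟩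
      · refine .inr ⟨a', Pa', xa', ?_, za'⟩
        rintro rfl
        exact naa' za.symm
    · by_cases hza : a = z
      · exact .inr ⟨a', Pa', xa', hza ▸ haa'.symm, hza ▸ naa'⟩
      · exact .inr ⟨a, Pa, xa, hza, za⟩
  rcases aux xz Pa Pa' xa xa' haa' naa' with hz | ⟨p, Pp, xp, hpz, nzp⟩
  · exact .inl ⟨a, a', Pa, Pa', xa, xa', hz.1, hz.2, haa', naa'⟩
  rcases aux xz.symm Pc Pc' zc zc' hcc' ncc' with hx | ⟨q, Pq, zq, hqx, nxq⟩
  · exact .inl ⟨c, c', Pc, Pc', hx.1, hx.2, zc, zc', hcc', ncc'⟩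
  refine .inr ⟨p, q, Pp, Pq, xp, zq, nzp, nxq, fun pq => ?_⟩
  exact h.c4 xp.symm xz zq pq.symm (fun e => nzp e.symm) nxq hpz hqx.symm

/-- Two disjoint anticomplete edges have a simplicial end. -/
theorem false_of_nonsimplicial_edges (h : HolePatternFree G) {x z y w : V}
    (xz : G.Adj x z) (yw : G.Adj y w) (nxy : ¬ G.Adj x y) (nxw : ¬ G.Adj x w)
    (nzy : ¬ G.Adj z y) (nzw : ¬ G.Adj z w)
    (hx : Nonsimplicial G x) (hz : Nonsimplicial G z) (hy : Nonsimplicial G y)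
    (hw : Nonsimplicial G w) : False := by
  have hxy : x ≠ y := by
    rintro rfl
    exact nxw yw
  have hxw : x ≠ w := by
    rintro rfl
    exact nxy yw.symm
  have hzy : z ≠ y := by
    rintro rfl
    exact nzw yw
  have hzw : z ≠ w := by
    rintro rfl
    exact nzy yw.symm
  -- In the bad case a common neighbour `u` of `x` and `y` misses `z`, a private neighbour of `x`.
  -- Then `x u` is an edge between the private neighbourhoods of `z` and `y`.
  have priv : ∀ {x z y w : V}, x ≠ y → x ≠ w → z ≠ y → z ≠ w → G.Adj x z → G.Adj y w →
      ¬ G.Adj x y → ¬ G.Adj x w → ¬ G.Adj z y → ¬ G.Adj z w → Nonsimplicial G x →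
      Nonsimplicial G z → Nonsimplicial G y → Nonsimplicial G w →
      PrivatelyNonsimplicial G x y := by
    intro x z y w hxy hxw hzy hzw xz yw nxy nxw nzy nzw hx hz hy hw
    rcases h.dominates_or_dominates hxy nxy with d | d
    · exact hx.privately d
    · rcases h.privatelyNonsimplicial_or hxy.symm (fun e => nxy e.symm) hy hx d with
        hp | ⟨-, u, yu, xu, hu⟩
      · exact hp
      · have nuz := hu z xz (fun e => nzy e.symm)
        exact (h.not_adj_private hzy nzy hz hy xz.symm (fun e => nxy e.symm) yu
          (fun e => nuz e.symm) xu).elim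
  have hcom : ∀ {x z y : V}, y ≠ z → G.Adj x z → ¬ G.Adj y x → ¬ G.Adj y z →
      Nonsimplicial G z → Nonsimplicial G y → ∀ {u}, G.Adj x u → G.Adj y u → G.Adj z u := by
    intro x z y hyz xz nyx nyz hz hy u xu yu
    by_contra nzu
    exact h.not_adj_private hyz nyz hy hz yu nzu xz.symm nyx xu.symm
  obtain ⟨a, a', xa, xa', haa', naa', nya, nya'⟩ :=
    priv hxy hxw hzy hzw xz yw nxy nxw nzy nzw hx hz hy hw
  obtain ⟨c, c', zc, zc', hcc', ncc', nyc, nyc'⟩ :=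
    priv hzy hzw hxy hxw xz.symm yw nzy nzw nxy nxw hz hx hy hw
  obtain ⟨b, b', yb, yb', hbb', nbb', nxb, nxb'⟩ :=
    priv hxy.symm hzy.symm hxw.symm hzw.symm yw xz (fun e => nxy e.symm) (fun e => nzy e.symm)
      (fun e => nxw e.symm) (fun e => nzw e.symm) hy hw hx hz
  obtain ⟨d, d', wd, wd', hdd', ndd', nxd, nxd'⟩ :=
    priv hxw.symm hzw.symm hxy.symm hzy.symm yw.symm xz (fun e => nxw e.symm)
      (fun e => nzw e.symm) (fun e => nxy e.symm) (fun e => nzy e.symm) hw hy hx hz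
  have hxz : ∀ {u}, G.Adj y u → (G.Adj x u ↔ G.Adj z u) := fun yu =>
    ⟨fun xu => hcom hzy.symm xz (fun e => nxy e.symm) (fun e => nzy e.symm) hz hy xu yu,
      fun zu => hcom hxy.symm xz.symm (fun e => nzy e.symm) (fun e => nxy e.symm) hx hy zu yu⟩
  have hyw : ∀ {u}, G.Adj x u → (G.Adj y u ↔ G.Adj w u) := fun xu =>
    ⟨fun yu => hcom hxw yw nxy nxw hw hx yu xu, fun wu => hcom hxy yw.symm nxw nxy hy hx wu xu⟩
  have hyw' : ∀ {u}, G.Adj z u → (G.Adj y u ↔ G.Adj w u) := fun zu =>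
    ⟨fun yu => hcom hzw yw nzy nzw hw hz yu zu, fun wu => hcom hzy yw.symm nzw nzy hy hz wu zu⟩
  have hxz' : ∀ {u}, G.Adj w u → (G.Adj x u ↔ G.Adj z u) := fun wu =>
    ⟨fun xu => (hxz ((hyw xu).2 wu)).1 xu, fun zu => (hxz ((hyw' zu).2 wu)).2 zu⟩
  -- The two sides are anticomplete. Each contains a P₃ and, by `diamond_or_path`, either a diamond
  -- or a P₄. Two diamonds give F₆; a P₄ on one side and a P₃ on the other give F₂.
  let L : V → Prop := fun l => (G.Adj x l ∨ G.Adj z l) ∧ ¬ G.Adj y l ∧ ¬ G.Adj w l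
  let R : V → Prop := fun r => (G.Adj y r ∨ G.Adj w r) ∧ ¬ G.Adj x r ∧ ¬ G.Adj z r
  have hLR : ∀ {l r}, L l → R r → ¬ G.Adj l r := by
    rintro l r ⟨xl | zl, nyl, nwl⟩ ⟨yr | wr, nxr, nzr⟩
    · exact h.not_adj_private hxy nxy hx hy xl nyl yr nxr
    · exact h.not_adj_private hxw nxw hx hw xl nwl wr nxr
    · exact h.not_adj_private hzy nzy hz hy zl nyl yr nzr
    · exact h.not_adj_private hzw nzw hz hw zl nwl wr nzr
  have Lx : L x := ⟨.inr xz.symm, fun e => nxy e.symm, fun e => nxw e.symm⟩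
  have Lz : L z := ⟨.inl xz, fun e => nzy e.symm, fun e => nzw e.symm⟩
  have Ry : R y := ⟨.inr yw.symm, nxy, nzy⟩
  have Rw : R w := ⟨.inl yw, nxw, nzw⟩
  have La : L a := ⟨.inl xa, nya, fun e => nya ((hyw xa).2 e)⟩
  have La' : L a' := ⟨.inl xa', nya', fun e => nya' ((hyw xa').2 e)⟩
  have Lc : L c := ⟨.inr zc, nyc, fun e => nyc ((hyw' zc).2 e)⟩
  have Lc' : L c' := ⟨.inr zc', nyc', fun e => nyc' ((hyw' zc').2 e)⟩
  have Rb : R b := ⟨.inl yb, nxb, fun e => nxb ((hxz yb).2 e)⟩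
  have Rb' : R b' := ⟨.inl yb', nxb', fun e => nxb' ((hxz yb').2 e)⟩
  have Rd : R d := ⟨.inr wd, nxd, fun e => nxd ((hxz' wd).2 e)⟩
  have Rd' : R d' := ⟨.inr wd', nxd', fun e => nxd' ((hxz' wd').2 e)⟩
  have hanti : ∀ {l₁ l₂ : List V}, (∀ s ∈ l₁, L s) → (∀ t ∈ l₂, R t) →
      ∀ s ∈ l₁, ∀ t ∈ l₂, ¬ G.Adj s t := fun h₁ h₂ s hs t ht => hLR (h₁ s hs) (h₂ t ht)
  clear_value L R
  rcases h.diamond_or_path L xz La La' Lc Lc' xa xa' haa' naa' zc zc' hcc' ncc' with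
    ⟨p, q, Lp, Lq, xp, xq, zp, zq, hpq, npq⟩ | ⟨p, q, Lp, Lq, xp, zq, nzp, nxq, npq⟩
  · rcases h.diamond_or_path R yw Rb Rb' Rd Rd' yb yb' hbb' nbb' wd wd' hdd' ndd' with
      ⟨r, s, Rr, Rs, yr, ys, wr, ws, hrs, nrs⟩ | ⟨r, r', Rr, Rr', yr, wr', nwr, nyr', nrr'⟩
    · exact h.f6 xz xp xq zp zq yw yr ys wr ws npq nrs hpq hrs
        (hanti (by simp [*]) (by simp [*]))
    · exact h.f2 yr.symm yw wr' xa xa' (fun e => nwr e.symm) nrr' nyr' naa' haa'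
        fun t ht s hs e => hanti (l₁ := [a, x, a']) (l₂ := [r, y, w, r']) (by simp [*])
          (by simp [*]) s hs t ht e.symm
  · exact h.f2 xp.symm xz zq yb yb' (fun e => nzp e.symm) npq nxq nbb' hbb'
      (hanti (by simp [*]) (by simp [*]))

/-- Every vertex has a neighbour in the other pair, as the absence of independent triples ensures
for b-vertices. The four vertices thus induce C₄, P₄ or two disjoint edges. -/
theorem false_of_nonadjacent_pairs (h : HolePatternFree G) {x y z w : V}
    (hxy : x ≠ y) (hzw : z ≠ w)
    (nxy : ¬ G.Adj x y) (nzw : ¬ G.Adj z w)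
    (hx : Nonsimplicial G x) (hy : Nonsimplicial G y) (hz : Nonsimplicial G z)
    (hw : Nonsimplicial G w)
    (h₁ : G.Adj x z ∨ G.Adj x w) (h₂ : G.Adj y z ∨ G.Adj y w)
    (h₃ : G.Adj x z ∨ G.Adj y z) (h₄ : G.Adj x w ∨ G.Adj y w) : False := by
  have p := fun {z x w y : V} => h.false_of_nonsimplicial_path (z := z) (x := x) (w := w) (y := y)
  by_cases xz : G.Adj x z <;> by_cases xw : G.Adj x w <;> by_cases yz : G.Adj y z <;>
    by_cases yw : G.Adj y w <;>
    try first
      | exact (not_or.2 ⟨xz, xw⟩ h₁).elim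
      | exact (not_or.2 ⟨yz, yw⟩ h₂).elim
      | exact (not_or.2 ⟨xz, yz⟩ h₃).elim
      | exact (not_or.2 ⟨xw, yw⟩ h₄).elim
  · exact h.c4 xz yz.symm yw xw.symm nxy nzw hxy hzw
  · exact p xw.symm xz yz.symm nxy (fun e => nzw e.symm) yw hw hy
  · exact p xz.symm xw yw.symm nxy nzw yz hz hy
  · exact p yw.symm yz xz.symm (fun e => nxy e.symm) (fun e => nzw e.symm) xw hw hx
  · exact h.false_of_nonsimplicial_edges xz yw nxy xw (fun e => yz e.symm) nzw hx hz hy hw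
  · exact p yz.symm yw xw.symm (fun e => nxy e.symm) nzw xz hz hx
  · exact h.false_of_nonsimplicial_edges xw yz nxy xz (fun e => yw e.symm) (fun e => nzw e.symm)
      hx hw hy hz

/-! ### Stars of non-adjacent b-vertices and the resulting clique -/

/-- For adjacent `y`, `y'` not adjacent to `x`, the neighbourhoods of `y` and `y'` in the color
class of `x` are comparable. -/
theorem false_of_incomparable (h : HolePatternFree G) {x y y' w w' s s' : V}
    (hxy : x ≠ y) (hxy' : x ≠ y') (nxy : ¬ G.Adj x y) (nxy' : ¬ G.Adj x y') (yy' : G.Adj y y')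
    (hx : Nonsimplicial G x) (hy : Nonsimplicial G y) (hy' : Nonsimplicial G y')
    (yw : G.Adj y w) (ny'w : ¬ G.Adj y' w) (y'w' : G.Adj y' w') (nyw' : ¬ G.Adj y w')
    (nww' : ¬ G.Adj w w') (nxw : ¬ G.Adj x w) (nxw' : ¬ G.Adj x w')
    (xs : G.Adj x s) (nys : ¬ G.Adj y s) (xs' : G.Adj x s') (ny's' : ¬ G.Adj y' s')
    (hss' : s ≠ s') : False := by
  -- The path `w y y' w'` together with `a x a'` would be F₂.
  have key : ∀ {a a'}, G.Adj x a → G.Adj x a' → a ≠ a' → ¬ G.Adj a a' → ¬ G.Adj y a →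
      ¬ G.Adj y a' → ¬ G.Adj y' a → ¬ G.Adj y' a' → False := by
    intro a a' xa xa' haa' naa' nya nya' ny'a ny'a'
    have h1 := h.not_adj_private hxy nxy hx hy xa nya yw nxw
    have h2 := h.not_adj_private hxy nxy hx hy xa' nya' yw nxw
    have h3 := h.not_adj_private hxy' nxy' hx hy' xa ny'a y'w' nxw'
    have h4 := h.not_adj_private hxy' nxy' hx hy' xa' ny'a' y'w' nxw'
    apply @h.f2 w y y' w' a x a' <;>
      (try simp only [List.forall_mem_cons, List.not_mem_nil, false_imp_iff, implies_true,
        and_true]) <;> grind [G.adj_comm]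
  -- Stated for variable `y`, `y'` because it is used in both orders. Once `x` dominates both, any
  -- non-adjacent pair at `x` is private to both and contradicts `key`.
  have main : ∀ {y y' w w' s s'}, x ≠ y → x ≠ y' → ¬ G.Adj x y → ¬ G.Adj x y' → G.Adj y y' →
      Nonsimplicial G y → Nonsimplicial G y' → G.Adj y w → ¬ G.Adj y' w → G.Adj y' w' →
      ¬ G.Adj y w' → ¬ G.Adj w w' → ¬ G.Adj x w → ¬ G.Adj x w' → G.Adj x s → ¬ G.Adj y s →
      G.Adj x s' → ¬ G.Adj y' s' → s ≠ s' →
      (∀ {a a'}, G.Adj x a → G.Adj x a' → a ≠ a' → ¬ G.Adj a a' → ¬ G.Adj y a →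
        ¬ G.Adj y a' → ¬ G.Adj y' a → ¬ G.Adj y' a' → False) → Dominates G x y := by
    intro y y' w w' s s' hxy hxy' nxy nxy' yy' hy hy' yw ny'w y'w' nyw' nww' nxw nxw' xs nys xs'
      ny's' hss' key
    by_contra nd
    have nyx : ¬ G.Adj y x := fun e => nxy e.symm
    have d := (h.dominates_or_dominates hxy nxy).resolve_left nd
    have hsub : ∀ {v}, G.Adj x v → G.Adj y v → G.Adj y' v := fun {v} xv yv =>
      (d v yv xv y' yy' (by rintro rfl; exact nxy' xv)).symm
    have hsub' : (∃ v, G.Adj x v ∧ G.Adj y' v ∧ ∃ r, G.Adj x r ∧ r ≠ v ∧ ¬ G.Adj v r) →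
        ∀ {v}, G.Adj x v → G.Adj y' v → G.Adj y v := by
      rintro ⟨u, xu, y'u, r, xr, hru, nur⟩ v xv y'v
      have d' := (h.dominates_or_dominates hxy' nxy').resolve_left fun d => nur (d u xu y'u r xr hru)
      exact (d' v y'v xv y yy'.symm (by rintro rfl; exact nxy xv)).symm
    rcases h.privatelyNonsimplicial_or hxy.symm nyx hy hx d with
      ⟨a, a', xa, xa', haa', naa', nya, nya'⟩ | ⟨hX, u, yu, xu, hu⟩
    · refine key xa xa' haa' naa' nya nya' (fun e => nya ?_) (fun e => nya' ?_)
      · exact hsub' ⟨a, xa, e, a', xa', haa'.symm, naa'⟩ xa e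
      · exact hsub' ⟨a', xa', e, a, xa, haa', fun e => naa' e.symm⟩ xa' e
    · have nus := hu s xs nys
      have hsu : s ≠ u := by
        rintro rfl
        exact nys yu
      have y'u := hsub xu yu
      have hsub'' := fun {v} => hsub' ⟨u, xu, y'u, s, xs, hsu, nus⟩ (v := v)
      have ny's : ¬ G.Adj y' s := fun e => nys (hsub'' xs e)
      have nys' : ¬ G.Adj y s' := fun e => ny's' (hsub xs' e)
      have uw := d u yu xu w yw (by rintro rfl; exact nxw xu)
      have d' := (h.dominates_or_dominates hxy' nxy').resolve_left fun e =>
        nus (e u xu y'u s xs hsu)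
      have uw' := d' u y'u xu w' y'w' (by rintro rfl; exact nxw' xu)
      have h2 := hu s' xs' nys'
      have h3 := hX s s' xs nys xs' nys' hss'
      have h4 := h.not_adj_private hxy nxy hx hy xs nys yw nxw
      have h5 := h.not_adj_private hxy nxy hx hy xs' nys' yw nxw
      have h6 := h.not_adj_private hxy' nxy' hx hy' xs ny's y'w' nxw'
      have h7 := h.not_adj_private hxy' nxy' hx hy' xs' ny's' y'w' nxw'
      clear hsub hsub' hsub'' key hX hu d d'
      apply @h.f8 u w y y' w' x s s' <;>
        (try simp only [List.forall_mem_cons, List.not_mem_nil, false_imp_iff, implies_true,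
          and_true]) <;> grind [G.adj_comm]
  have d := main hxy hxy' nxy nxy' yy' hy hy' yw ny'w y'w' nyw' nww' nxw nxw' xs nys xs' ny's' hss'
    key
  have d' := main hxy' hxy nxy' nxy yy'.symm hy' hy y'w' nyw' yw ny'w (fun e => nww' e.symm) nxw'
    nxw xs' ny's' xs nys hss'.symm
    (fun h1 h2 h3 h4 h5 h6 h7 h8 => key h1 h2 h3 h4 h7 h8 h5 h6)
  obtain ⟨a, a', xa, xa', haa', naa'⟩ := hx
  exact key xa xa' haa' naa' (fun e => naa' (d a xa e a' xa' haa'.symm))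
    (fun e => naa' (d a' xa' e a xa haa').symm) (fun e => naa' (d' a xa e a' xa' haa'.symm))
    (fun e => naa' (d' a' xa' e a xa haa').symm)


/-- The clique produced when all but one of the chosen b-vertices are pairwise adjacent. -/
theorem exists_clique_of_star [Finite V] (h : HolePatternFree G) {k : ℕ} (C : G.Coloring (Fin k))
    (b : Fin k → V) (hbC : ∀ i, C (b i) = i)
    (hb : ∀ i j, j ≠ i → ∃ w, G.Adj (b i) w ∧ C w = j) (hns : ∀ i, Nonsimplicial G (b i))
    (c : Fin k) (hc : ∀ i j, i ≠ c → j ≠ c → i ≠ j → G.Adj (b i) (b j))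
    (hQ : ∃ l, l ≠ c ∧ ¬ G.Adj (b c) (b l)) :
    ∃ f : Fin k → V, ∀ i j, i ≠ j → G.Adj (f i) (f j) := by
  have hne : ∀ {i j}, i ≠ j → b i ≠ b j := fun {i j} hij e =>
    hij (by rw [← hbC i, e, hbC])
  have hcol : ∀ {u v}, C u = C v → ¬ G.Adj u v := fun e huv => C.valid huv e
  let N : Fin k → Set V := fun i => {w | G.Adj (b i) w ∧ C w = c}
  -- By `false_of_incomparable` the sets `N m`, for `b m` not adjacent to the centre, form a chain.
  -- A member `w` of the smallest one is adjacent to all these vertices.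
  obtain ⟨l, ⟨hlc, hxl⟩, hmin⟩ := Set.exists_min_image {l | l ≠ c ∧ ¬ G.Adj (b c) (b l)}
    (fun l => (N l).ncard) (Set.toFinite _) hQ
  obtain ⟨w, hlw, hwc⟩ := hb l c hlc.symm
  have hxw : ¬ G.Adj (b c) w := hcol (by rw [hbC, hwc])
  have hw : ∀ m, m ≠ c → ¬ G.Adj (b c) (b m) → G.Adj (b m) w := by
    intro m hmc hxm
    by_contra hmw
    have hml : m ≠ l := by
      rintro rfl
      exact hmw hlw
    have hsub : N m ⊆ N l := by
      rintro w' ⟨hmw', hw'c⟩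
      refine ⟨?_, hw'c⟩
      by_contra hlw'
      obtain ⟨s, hs, hsl⟩ := hb c l hlc
      obtain ⟨s', hs', hsm⟩ := hb c m hmc
      exact h.false_of_incomparable (hne hlc.symm) (hne hmc.symm) hxl hxm (hc l m hlc hmc hml.symm)
        (hns c) (hns l) (hns m) hlw hmw hmw' hlw' (hcol (by rw [hwc, hw'c])) hxw
        (hcol (by rw [hbC, hw'c])) hs (hcol (by rw [hbC, hsl])) hs' (hcol (by rw [hbC, hsm]))
        (by rintro rfl; exact hml (hsm.symm.trans hsl))
    exact absurd (hmin m ⟨hmc, hxm⟩) (not_le.2 (Set.ncard_lt_ncard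
      (hsub.ssubset_of_mem_notMem (a := w) ⟨hlw, hwc⟩ fun hm => hmw hm.1) (Set.toFinite _)))
  -- If `w` is adjacent to all leaves, it replaces the centre.
  by_cases hall : ∀ m, m ≠ c → G.Adj (b m) w
  · refine ⟨Function.update b c w, fun i j hij => ?_⟩
    by_cases hi : i = c
    · subst hi
      simpa [Function.update_of_ne hij.symm] using (hall j hij.symm).symm
    · by_cases hj : j = c
      · subst hj
        simpa [Function.update_of_ne hij] using hall i hij
      · simpa [Function.update_of_ne hi, Function.update_of_ne hj] using hc i j hi hj hij
  push Not at hall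
  obtain ⟨m, hmc, hmw⟩ := hall
  have hxm : G.Adj (b c) (b m) := by
    by_contra hxm
    exact hmw (hw m hmc hxm)
  have hml : m ≠ l := by
    rintro rfl
    exact hxl hxm
  have d : Dominates G (b c) (b l) :=
    (h.dominates_or_dominates (hne hlc.symm) hxl).resolve_right fun d =>
      hmw (d (b m) (hc l m hlc hmc hml.symm) hxm w hlw (by rintro rfl; exact hxw hxm))
  -- A second non-neighbour `b i` of the centre is adjacent to `b m` and to `w`, so
  -- `adj_of_dominates` would give the missing edge from `b m` to `w`. Hence `b l` is the only one,
  -- and a neighbour of the centre in color `l` can replace it.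
  have huniq : ∀ i, i ≠ c → i ≠ l → G.Adj (b c) (b i) := by
    intro i hic hil
    by_contra hxi
    have him : i ≠ m := by
      rintro rfl
      exact hxi hxm
    exact hmw (h.adj_of_dominates (hne hlc.symm) hxl (hns c) (hns l) d hxm
      (hc l m hlc hmc hml.symm) (hc l i hlc hic hil.symm) hxi hlw hxw (hw i hic hxi)
      (hc m i hmc hic him.symm))
  obtain ⟨s, hs, hsl⟩ := hb c l hlc
  have hadj : ∀ i, i ≠ l → G.Adj (b i) s := by
    intro i hil
    by_cases hic : i = c
    · exact hic ▸ hs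
    · exact d (b i) (huniq i hic hil) (hc l i hlc hic hil.symm) s hs
        (by rintro rfl; exact hil ((hbC i).symm.trans hsl))
  have hcc : ∀ i j, i ≠ l → j ≠ l → i ≠ j → G.Adj (b i) (b j) := by
    intro i j hi hj hij
    by_cases hic : i = c
    · subst hic
      exact huniq j hij.symm hj
    · by_cases hjc : j = c
      · subst hjc
        exact (huniq i hij hi).symm
      · exact hc i j hic hjc hij
  refine ⟨Function.update b l s, fun i j hij => ?_⟩
  by_cases hi : i = l
  · subst hi
    simpa [Function.update_of_ne hij.symm] using (hadj j hij.symm).symm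
  · by_cases hj : j = l
    · subst hj
      simpa [Function.update_of_ne hij] using hadj i hij
    · simpa [Function.update_of_ne hi, Function.update_of_ne hj] using hcc i j hi hj hij

/-- A graph in the class with a b-coloring with `k` colors has a clique of size `k`. -/
theorem exists_clique [Finite V] (h : HolePatternFree G) {k : ℕ} (C : G.Coloring (Fin k))
    (hC : IsBColoring G C) : ∃ f : Fin k → V, ∀ i j, i ≠ j → G.Adj (f i) (f j) := by
  choose b hbC hb using hC
  -- A default vertex is needed by `choose!`.
  rcases isEmpty_or_nonempty V with hV | hV
  · exact ⟨b, fun i => (hV.false (b i)).elim⟩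
  choose! r hr hrC using hb
  by_cases hns : ∀ i, Nonsimplicial G (b i)
  swap
  · push Not at hns
    obtain ⟨i, hi⟩ := hns
    refine ⟨fun j => if j = i then b i else r i j, fun j l hjl => ?_⟩
    by_cases hj : j = i
    · simpa [hj, (hj ▸ hjl : i ≠ l).symm] using hr i l (hj ▸ hjl.symm)
    by_cases hl : l = i
    · simpa [hl, hj] using (hr i j hj).symm
    simp only [hj, hl, if_false]
    by_contra hadj
    exact hi ⟨_, _, hr i j hj, hr i l hl,
      fun e => hjl (by rw [← hrC i j hj, ← hrC i l hl, e]), hadj⟩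
  have hne : ∀ {i j}, i ≠ j → b i ≠ b j := fun {i j} hij e =>
    hij (by rw [← hbC i, e, hbC])
  have hcol : ∀ {u v}, C u = C v → ¬ G.Adj u v := fun e huv => C.valid huv e
  have hr' : ∀ {i j}, j ≠ i → ¬ G.Adj (b j) (r i j) := fun hij =>
    hcol (by rw [hbC, hrC _ _ hij])
  have hrr : ∀ {i j l}, j ≠ i → l ≠ i → j ≠ l → r i j ≠ r i l := fun hj hl hjl e =>
    hjl (by rw [← hrC _ _ hj, ← hrC _ _ hl, e])
  have triple : ∀ {i j l}, i ≠ j → i ≠ l → j ≠ l → ¬ G.Adj (b i) (b j) → ¬ G.Adj (b i) (b l) →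
      ¬ G.Adj (b j) (b l) → False := fun {i j l} hij hil hjl nij nil njl =>
    h.false_of_independent_triple (hne hij) (hne hil) (hne hjl) nij nil njl (hns i) (hns j) (hns l)
      (hr i j hij.symm) (hr' hij.symm) (hr i l hil.symm) (hr' hil.symm)
      (hrr hij.symm hil.symm hjl) (hr j i hij) (hr' hij) (hr j l hjl.symm) (hr' hjl.symm)
      (hrr hij hjl.symm hil) (hr l i hil) (hr' hil) (hr l j hjl) (hr' hjl) (hrr hil hjl hij)
  have pairs : ∀ {i j l m}, i ≠ j → l ≠ m → i ≠ l → i ≠ m → j ≠ l → j ≠ m →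
      ¬ G.Adj (b i) (b j) → ¬ G.Adj (b l) (b m) → False := by
    intro i j l m hij hlm hil him hjl hjm nij nlm
    refine h.false_of_nonadjacent_pairs (hne hij) (hne hlm) nij nlm (hns i) (hns j) (hns l) (hns m)
      ?_ ?_ ?_ ?_ <;> by_contra! hc
    · exact triple hil him hlm hc.1 hc.2 nlm
    · exact triple hjl hjm hlm hc.1 hc.2 nlm
    · exact triple hij hil hjl nij hc.1 hc.2
    · exact triple hij him hjm nij hc.1 hc.2
  by_cases hcl : ∀ i j, i ≠ j → G.Adj (b i) (b j)
  · exact ⟨b, hcl⟩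
  push Not at hcl
  obtain ⟨p, q, hpq, npq⟩ := hcl
  have star : ∀ c l, c ≠ l → ¬ G.Adj (b c) (b l) →
      (∀ i j, i ≠ c → j ≠ c → i ≠ j → G.Adj (b i) (b j)) →
      ∃ f : Fin k → V, ∀ i j, i ≠ j → G.Adj (f i) (f j) := fun c l hcl ncl hc =>
    h.exists_clique_of_star C b hbC (fun i j hij => ⟨r i j, hr i j hij, hrC i j hij⟩) hns c hc
      ⟨l, hcl.symm, ncl⟩
  by_cases hp : ∀ i j, i ≠ p → j ≠ p → i ≠ j → G.Adj (b i) (b j)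
  · exact star p q hpq npq hp
  -- Some non-adjacent pair avoids `p`, hence meets `q`, giving a second non-neighbour `s` of `q`. A
  -- non-adjacent pair avoiding `q` would form a triangle of non-adjacencies or be disjoint from `p
  -- q` or `q s`.
  refine star q p hpq.symm (fun e => npq e.symm) fun i j hiq hjq hij => ?_
  obtain ⟨s, hsp, hsq, nqs⟩ : ∃ s, s ≠ p ∧ s ≠ q ∧ ¬ G.Adj (b q) (b s) := by
    push Not at hp
    obtain ⟨s, t, hsp, htp, hst, nst⟩ := hp
    by_cases hs : s = q
    · exact ⟨t, htp, hs ▸ hst.symm, hs ▸ nst⟩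
    · by_cases ht : t = q
      · exact ⟨s, hsp, hs, fun e => nst (ht ▸ e.symm)⟩
      · exact (pairs hpq hst hsp.symm htp.symm (Ne.symm hs) (Ne.symm ht) npq nst).elim
  by_contra nij
  have hps : ∀ {j}, j ≠ q → j ≠ p → ¬ G.Adj (b p) (b j) → False := by
    intro j hjq hjp npj
    by_cases hjs : j = s
    · subst hjs
      exact triple hpq hsp.symm hsq.symm npq npj nqs
    · exact pairs hjp.symm hsq.symm hpq hsp.symm hjq hjs npj nqs
  by_cases hip : i = p
  · exact hps hjq (fun e => hij (hip.trans e.symm)) (hip ▸ nij)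
  · by_cases hjp : j = p
    · exact hps hiq hip fun e => nij (hjp ▸ e.symm)
    · exact pairs hpq hij (Ne.symm hip) (Ne.symm hjp) (Ne.symm hiq) (Ne.symm hjq) npq nij

end HolePatternFree

/-! ### Graphs with an induced pentagon -/

/-- The vertices `a, b, c, d, e` induce a cycle of length five, in this order. -/
structure IsPentagon (G : SimpleGraph V) (a b c d e : V) : Prop where
  ab : G.Adj a b
  bc : G.Adj b c
  cd : G.Adj c d
  de : G.Adj d e
  ea : G.Adj e a
  ac : ¬ G.Adj a c
  bd : ¬ G.Adj b d
  ce : ¬ G.Adj c e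
  da : ¬ G.Adj d a
  eb : ¬ G.Adj e b

theorem IsPentagon.rotate {a b c d e : V} (p : IsPentagon G a b c d e) :
    IsPentagon G b c d e a :=
  ⟨p.bc, p.cd, p.de, p.ea, p.ab, p.bd, p.ce, p.da, p.eb, p.ac⟩

/-- If `v b` is missing, C₄-freeness excludes `v c`. Then `v d` forces `v e` and F₁₆, while its
absence leaves the path `v a b c d`. Rotating, adjacency to one vertex of the pentagon spreads to
all. -/
theorem PatternFree.adj_succ_of_isPentagon (h : PatternFree G) {a b c d e v : V}
    (p : IsPentagon G a b c d e) (hv : v ∉ [a, b, c, d, e]) (va : G.Adj v a) : G.Adj v b := by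
  by_contra vb
  obtain ⟨ab, bc, cd, de, ea, ac, bd, ce, da, eb⟩ := p
  simp only [List.mem_cons, List.not_mem_nil, or_false, not_or] at hv
  have vc : ¬ G.Adj v c := fun vc => by
    apply @h.c4 v a b c <;> grind [G.adj_comm]
  by_cases vd : G.Adj v d
  · have ve : G.Adj v e := by
      by_contra ve
      apply @h.c4 v a e d <;> grind [G.adj_comm]
    apply @h.f16 d e a b c v <;> grind [G.adj_comm]
  · apply @h.p5 v a b c d <;> grind [G.adj_comm]

theorem PatternFree.adj_all_of_isPentagon (h : PatternFree G) {a b c d e v : V}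
    (p : IsPentagon G a b c d e) (hv : v ∉ [a, b, c, d, e]) (va : G.Adj v a) :
    ∀ i ∈ [a, b, c, d, e], G.Adj v i := by
  have vb := h.adj_succ_of_isPentagon p hv va
  have vc := h.adj_succ_of_isPentagon p.rotate (by grind) vb
  have vd := h.adj_succ_of_isPentagon p.rotate.rotate (by grind) vc
  have ve := h.adj_succ_of_isPentagon p.rotate.rotate.rotate (by grind) vd
  simp [*]

theorem PatternFree.not_adj_of_isPentagon (h : PatternFree G) {a b c d e v : V}
    (p : IsPentagon G a b c d e) (hv : v ∉ [a, b, c, d, e])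
    (hA : ¬ ∀ i ∈ [a, b, c, d, e], G.Adj v i) : ∀ i ∈ [a, b, c, d, e], ¬ G.Adj v i := by
  have va : ¬ G.Adj v a := fun e => hA (h.adj_all_of_isPentagon p hv e)
  have ve : ¬ G.Adj v e := fun ve =>
    va (h.adj_succ_of_isPentagon p.rotate.rotate.rotate.rotate (by grind) ve)
  have vd : ¬ G.Adj v d := fun vd =>
    ve (h.adj_succ_of_isPentagon p.rotate.rotate.rotate (by grind) vd)
  have vc : ¬ G.Adj v c := fun vc => vd (h.adj_succ_of_isPentagon p.rotate.rotate (by grind) vc)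
  have vb : ¬ G.Adj v b := fun vb => vc (h.adj_succ_of_isPentagon p.rotate (by grind) vb)
  simp [*]

/-- A proper coloring uses three colors on a cycle of length five. -/
theorem IsPentagon.exists_three_colors {a b c d e : V} (p : IsPentagon G a b c d e) {α : Type*}
    (D : G.Coloring α) : ∃ x ∈ [a, b, c, d, e], ∃ y ∈ [a, b, c, d, e], ∃ z ∈ [a, b, c, d, e],
      D x ≠ D y ∧ D x ≠ D z ∧ D y ≠ D z := by
  have ab := D.valid p.ab
  have bc := D.valid p.bc
  have cd := D.valid p.cd
  have de := D.valid p.de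
  have ea := D.valid p.ea
  by_cases h1 : D c = D a
  · by_cases h2 : D d = D b
    · exact ⟨a, by simp, b, by simp, e, by simp, ab, ea.symm, h2 ▸ de⟩
    · exact ⟨a, by simp, b, by simp, d, by simp, ab, h1 ▸ cd, Ne.symm h2⟩
  · exact ⟨a, by simp, b, by simp, c, by simp, ab, Ne.symm h1, bc⟩

theorem le_of_clique {k n : ℕ} (hn : G.Colorable n) (f : Fin k → V)
    (hf : ∀ i j, i ≠ j → G.Adj (f i) (f j)) : k ≤ n := by
  obtain ⟨D⟩ := hn
  have hinj : Function.Injective fun i => D (f i) := fun i j hij => by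
    by_contra hne
    exact D.valid (hf i j hne) hij
  simpa using Fintype.card_le_of_injective _ hinj

/-- The number of colors seen by a b-vertex is bounded by the size of its neighbourhood. -/
theorem le_card_of_neighbors {k : ℕ} (C : G.Coloring (Fin k)) {i : Fin k} {v : V}
    (hv : ∀ j, j ≠ i → ∃ w, G.Adj v w ∧ C w = j) (S : Finset V) (hS : ∀ w, G.Adj v w → w ∈ S) :
    k ≤ S.card + 1 := by
  classical
  have hsub : Finset.univ.erase i ⊆ S.image C := fun j hj => by
    obtain ⟨w, hw, rfl⟩ := hv j (Finset.ne_of_mem_erase hj)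
    exact Finset.mem_image_of_mem _ (hS w hw)
  have h1 := (Finset.card_le_card hsub).trans Finset.card_image_le
  rw [Finset.card_erase_of_mem (Finset.mem_univ i), Finset.card_univ, Fintype.card_fin] at h1
  omega

theorem PatternFree.le_of_isPentagon [Finite V] (h : PatternFree G) {a b c d e : V}
    (p : IsPentagon G a b c d e) {k n : ℕ} (C : G.Coloring (Fin k)) (hC : IsBColoring G C)
    (hn : G.Colorable n) : k ≤ n := by
  classical
  have := Fintype.ofFinite V
  let A : Finset V := {v | ∀ i ∈ [a, b, c, d, e], G.Adj v i}
  have hA : ∀ v, v ∈ A ↔ ∀ i ∈ [a, b, c, d, e], G.Adj v i := fun v => by simp [A]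
  clear_value A
  have hAcl : ∀ u ∈ A, ∀ v ∈ A, u ≠ v → G.Adj u v := by
    intro u hu v hv huv
    rw [hA] at hu hv
    have hac : a ≠ c := by
      rintro rfl
      exact p.da p.cd.symm
    exact h.adj_of_common hac p.ac (hu a (by simp)).symm (hu c (by simp)).symm
      (hv a (by simp)).symm (hv c (by simp)).symm huv
  have hAn : A.card + 3 ≤ n := by
    obtain ⟨D⟩ := hn
    obtain ⟨x, hx, y, hy, z, hz, hxy, hxz, hyz⟩ := p.exists_three_colors D
    have hdisj : Disjoint (A.image D) {D x, D y, D z} := by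
      rw [Finset.disjoint_left]
      intro i hi hi'
      obtain ⟨v, hv, rfl⟩ := Finset.mem_image.1 hi
      rw [hA] at hv
      simp only [Finset.mem_insert, Finset.mem_singleton] at hi'
      rcases hi' with e | e | e
      · exact D.valid (hv x hx) e
      · exact D.valid (hv y hy) e
      · exact D.valid (hv z hz) e
    have hcard := Finset.card_le_univ (A.image D ∪ {D x, D y, D z})
    rw [Finset.card_union_of_disjoint hdisj, Finset.card_image_of_injOn,
      Finset.card_eq_three.2 ⟨_, _, _, hxy, hxz, hyz, rfl⟩, Fintype.card_fin] at hcard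
    · exact hcard
    · intro u hu v hv huv
      by_contra hne
      exact D.valid (hAcl u hu v hv hne) huv
  by_contra! hkn
  -- Here `|A| ≤ n - 3 < k`, so the clique `A` cannot meet every color.
  obtain ⟨i, hi⟩ : ∃ i, i ∉ A.image C := by
    by_contra! hall
    have h1 := (Finset.card_le_card (fun i _ => hall i : Finset.univ ⊆ A.image C)).trans
      Finset.card_image_le
    rw [Finset.card_univ, Fintype.card_fin] at h1
    omega
  obtain ⟨v, hvi, hv⟩ := hC i
  have hvA : v ∉ A := fun hvA => hi (hvi ▸ Finset.mem_image_of_mem C hvA)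
  -- A vertex of the pentagon has its neighbours in `A` and two cycle neighbours, so as a b-vertex
  -- it would give `k ≤ |A| + 3 ≤ n`.
  have hcyc : ∀ {a b c d e}, IsPentagon G a b c d e →
      (∀ v, v ∈ A ↔ ∀ i ∈ [a, b, c, d, e], G.Adj v i) → v ≠ a := by
    rintro a b c d e p hA rfl
    have h1 := le_card_of_neighbors C hv (insert b (insert e A)) fun w hw => by
      by_cases hwc : w ∈ [v, b, c, d, e]
      · simp only [List.mem_cons, List.not_mem_nil, or_false] at hwc
        rcases hwc with rfl | rfl | rfl | rfl | rfl
        · exact absurd hw G.irrefl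
        · simp
        · exact absurd hw p.ac
        · exact absurd hw.symm p.da
        · simp
      · rw [Finset.mem_insert, Finset.mem_insert, hA]
        exact .inr (.inr (h.adj_all_of_isPentagon p hwc hw.symm))
    have h2 := Finset.card_insert_le b (insert e A)
    have h3 := Finset.card_insert_le e A
    omega
  have hvc : v ∉ [a, b, c, d, e] := by
    simp only [List.mem_cons, List.not_mem_nil, or_false, not_or]
    refine ⟨hcyc p hA, hcyc p.rotate ?_, hcyc p.rotate.rotate ?_, hcyc p.rotate.rotate.rotate ?_,
      hcyc p.rotate.rotate.rotate.rotate ?_⟩ <;>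
    · intro u
      rw [hA]
      grind
  have hvB := h.not_adj_of_isPentagon p hvc fun e => hvA ((hA v).2 e)
  have hB : ∀ {t}, G.Adj v t → t ∉ A → ∀ i ∈ [a, b, c, d, e], ¬ G.Adj i t := by
    intro t vt htA i hi it
    refine h.not_adj_of_isPentagon p (fun ht => hvB t ht vt) (fun e => htA ((hA t).2 e)) i hi it.symm
  have hvB' : ∀ i ∈ [a, b, c, d, e], ¬ G.Adj i v := fun i hi e => hvB i hi e.symm
  -- Otherwise `s v t` and a P₄ of the pentagon form F₂.
  have hBB : ∀ {s t}, G.Adj v s → G.Adj v t → s ∉ A → t ∉ A → s ≠ t → G.Adj s t := by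
    intro s t vs vt hs ht hst
    by_contra hc
    refine h.f2 p.ab p.bc p.cd vs vt p.ac (fun e => p.da e.symm) p.bd hc hst ?_
    intro i hi j hj
    have hi' : i ∈ [a, b, c, d, e] := by grind
    simp only [List.mem_cons, List.not_mem_nil, or_false] at hj
    rcases hj with rfl | rfl | rfl
    exacts [hB vs hs i hi', hvB' i hi', hB vt ht i hi']
  have hthree : 3 ≤ (G.neighborFinset v \ A).card := by
    have h1 := le_card_of_neighbors C hv (A ∪ (G.neighborFinset v \ A)) fun w hw => by
      by_cases hwA : w ∈ A <;> simp [hw, hwA]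
    have h2 := Finset.card_union_le A (G.neighborFinset v \ A)
    omega
  -- A second neighbour `w` of `v` outside `A` forms a triangle with `v` and `t`. With the pentagon,
  -- this gives F₅ or F₈ according to whether `s w` is an edge.
  have hAB : ∀ {s t}, G.Adj v s → G.Adj v t → s ∈ A → t ∉ A → G.Adj s t := by
    intro s t vs vt hs ht
    by_contra hst
    obtain ⟨w, hw, hwt⟩ := Finset.exists_mem_ne (by omega : 1 < (G.neighborFinset v \ A).card) t
    rw [Finset.mem_sdiff, SimpleGraph.mem_neighborFinset] at hw
    obtain ⟨vw, hwA⟩ := hw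
    have hwt' := hBB vw vt hwA ht hwt
    rw [hA] at hs
    have h1 := hB vt ht
    have h2 := hB vw hwA
    have hac : a ≠ c := by
      rintro rfl
      exact p.da p.cd.symm
    obtain ⟨ab, bc, cd, de, ea, ac, bd, ce, da, eb⟩ := p
    simp only [List.forall_mem_cons, List.not_mem_nil, false_imp_iff, implies_true, and_true]
      at hs h1 h2 hvB'
    clear hB hBB hcyc hvB hA hv hAcl
    by_cases sw : G.Adj s w
    · apply @h.f5 s v w t b a c <;>
        (try simp only [List.forall_mem_cons, List.not_mem_nil, false_imp_iff, implies_true,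
          and_true]) <;> grind [G.adj_comm]
    · apply @h.f8 s a b c d v t w <;>
        (try simp only [List.forall_mem_cons, List.not_mem_nil, false_imp_iff, implies_true,
          and_true]) <;> grind [G.adj_comm]
  have hcl : ∀ {s t}, G.Adj v s → G.Adj v t → s ≠ t → G.Adj s t := by
    intro s t vs vt hst
    by_cases hs : s ∈ A <;> by_cases ht : t ∈ A
    · exact hAcl s hs t ht hst
    · exact hAB vs vt hs ht
    · exact (hAB vt vs ht hs).symm
    · exact hBB vs vt hs ht hst
  have : Nonempty V := ⟨v⟩
  choose! r hr hrC using hv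
  refine absurd (le_of_clique hn (fun j => if j = i then v else r j) fun j l hjl => ?_)
    (not_le.2 hkn)
  by_cases hj : j = i
  · simpa [hj, (hj ▸ hjl : i ≠ l).symm] using hr l (hj ▸ hjl.symm)
  by_cases hl : l = i
  · simpa [hl, hj] using (hr j hj).symm
  · simp only [hj, hl, if_false]
    exact hcl (hr j hj) (hr l hl) fun e => hjl (by rw [← hrC j hj, ← hrC l hl, e])

/-! ### Comparison of the b-chromatic and chromatic numbers -/

theorem PatternFree.le_of_hasBColoring [Finite V] (h : PatternFree G) {k n : ℕ}
    (hk : HasBColoring G k) (hn : G.Colorable n) : k ≤ n := by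
  obtain ⟨C, hC⟩ := hk
  by_cases hp : ∃ a b c d e, IsPentagon G a b c d e
  · obtain ⟨a, b, c, d, e, p⟩ := hp
    exact h.le_of_isPentagon p C hC hn
  · have h' : HolePatternFree G :=
      { h with
        c5 := fun ab bc cd de ea ac ad bd be ce => hp ⟨_, _, _, _, _, ab, bc, cd, de, ea, ac, bd,
          ce, fun e => ad e.symm, fun e => be e.symm⟩ }
    obtain ⟨f, hf⟩ := h'.exists_clique C hC
    exact le_of_clique hn f hf

/-- An optimal coloring is a b-coloring. -/
theorem hasBColoring_of_chromaticNumber_eq {n : ℕ} (hn : G.chromaticNumber = n) :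
    HasBColoring G n := by
  have hcol : G.Colorable n := SimpleGraph.chromaticNumber_le_iff_colorable.1 hn.le
  obtain ⟨C⟩ := hcol
  refine ⟨C, fun i => ?_⟩
  by_contra! hc
  -- Each vertex of a class without b-vertices can move to a color absent from its neighbourhood.
  -- The class is independent, so all can move at once and color `i` disappears.
  have hex : ∀ v, ∃ j, j ≠ i ∧ (C v ≠ i → j = C v) ∧
      (C v = i → ∀ w, G.Adj v w → C w ≠ j) := by
    intro v
    by_cases hv : C v = i
    · obtain ⟨j, hj, hw⟩ := hc v hv
      exact ⟨j, hj, fun e => absurd hv e, fun _ => hw⟩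
    · exact ⟨C v, hv, fun _ => rfl, fun e => absurd e hv⟩
  choose g hgi hg hg' using hex
  let D : G.Coloring {j : Fin n // j ≠ i} := SimpleGraph.Coloring.mk (fun v => ⟨g v, hgi v⟩) <| by
    intro v w hvw e
    have e : g v = g w := congrArg Subtype.val e
    by_cases hv : C v = i
    · by_cases hw : C w = i
      · exact C.valid hvw (hv.trans hw.symm)
      · exact hg' v hv w hvw ((hg w hw).symm.trans e.symm)
    · by_cases hw : C w = i
      · exact hg' w hw v hvw.symm ((hg v hv).symm.trans e)
      · exact C.valid hvw ((hg v hv).symm.trans (e.trans (hg w hw)))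
  have h1 := SimpleGraph.chromaticNumber_le_iff_colorable.2 D.colorable
  rw [hn, Fintype.card_subtype_compl, Fintype.card_fin, Fintype.card_subtype_eq] at h1
  have h2 : n ≤ n - 1 := by exact_mod_cast h1
  -- The existence of `i` makes `n` positive, so the truncated `n - 1` is smaller than `n`.
  have := i.pos
  omega

theorem bChromaticNumber_eq [Finite V]
    (h : ∀ k n, HasBColoring G k → G.Colorable n → k ≤ n) :
    (bChromaticNumber G : ℕ∞) = G.chromaticNumber := by
  have := Fintype.ofFinite V
  obtain ⟨n, hn⟩ := ENat.ne_top_iff_exists.1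
    (SimpleGraph.chromaticNumber_ne_top_iff_exists.2 ⟨_, G.colorable_of_fintype⟩)
  have hcol : G.Colorable n := SimpleGraph.chromaticNumber_le_iff_colorable.1 hn.symm.le
  have hgr : IsGreatest {k | HasBColoring G k} n :=
    ⟨hasBColoring_of_chromaticNumber_eq hn.symm, fun k hk => h k n hk hcol⟩
  rw [← hn, bChromaticNumber, hgr.csSup_eq]

end BPerfect

theorem theorem2 {V : Type*} [Finite V] (G : SimpleGraph V)
    (hF : BPerfect.IsFamilyFree BPerfect.familyF G)
    (hC4 : ¬ (SimpleGraph.cycleGraph 4).IsIndContained G) :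
    BPerfect.IsBPerfect G := by
  intro s
  have hs : (G.induce s).IsIndContained G := ⟨SimpleGraph.Embedding.induce s⟩
  exact BPerfect.bChromaticNumber_eq fun k n hk hn =>
    (BPerfect.patternFree_of_isFamilyFree (fun H hH hc => hF H hH (hc.trans hs))
      fun hc => hC4 (hc.trans hs)).le_of_hasBColoring hk hn
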